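/- **Notation.** Write $e(x)=\exp(2\pi i x)$, $q=e(\tau)$, and let $\left(\frac{-4}{m}\right)=\pm1$ if $m\equiv\pm1 \bmod 4$ and $0$ if $m$ is even. For $2\le k\le 8$ let $D_k=\{x\in\mathbb Z^k : x_1+\dots+x_k\in 2\mathbb Z\}$ with the Euclidean scalar product $(\cdot,\cdot)$, let $D_k^\vee$ be the dual lattice, $\ell^2=(\ell,\ell)$, and for $\ell=(l_1,\dots,l_k)\in D_k^\vee$ put $\left(\frac{-4}{2\ell}\right)=\prod_{i=1}^k\left(\frac{-4}{2l_i}\right)$. Let $$\vartheta(\tau,z)=\sum_{m\in\mathbb Z}\left(\frac{-4}{m}\right)e\!\left(\tfrac{m^2}{8}\tau+\tfrac m2 z\right),\qquad \psi_{12-k,D_k}(\tau,\mathfrak z)=\eta(\tau)^{24-3k}\,\vartheta(\tau,z_1)\cdots\vartheta(\tau,z_k),$$ where $\eta$ is the Dedekind eta function. For $Z=(\omega,\mathfrak z,\tau)\in\mathbb C\times\mathbb C^k\times\mathbb C$ with $\operatorname{Im}\tau>0$, $\operatorname{Im}\omega>0$ and $2\operatorname{Im}\tau\operatorname{Im}\omega-(\operatorname{Im}\mathfrak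 z,\operatorname{Im}\mathfrak z)>0$, put $$\mathrm{Lift}(\psi_{12-k,D_k})(Z)=\sum_{m\ge1}m^{-1}\sum_{ad=m,\ b\bmod d}a^{12-k}\,\psi_{12-k,D_k}\!\left(\tfrac{a\tau+b}{d},a\mathfrak z\right)e(m\omega).$$ For integers $m>0$ let $\tau_{3m}(n/8)$ be the Fourier coefficients of $\eta^{3m}$, $\eta(\tau)^{3m}=\sum_{n>0}\tau_{3m}(\tfrac n8)\,q^{n/8}$, with $\tau_{3m}(x)=0$ if $x\notin\frac18\mathbb Z_{>0}$; put $\tau_0(0)=1$ and $\tau_0(x)=0$ for $x\ne0$. A positive integer $d$ divides $(n,\ell,m)$ if $d\mid n$, $d\mid m$ and $\ell/d\in D_k^\vee$. **Corollary.** (1) Let $2\le k\le 8$. For every $Z$ as above the series defining $\mathrm{Lift}(\psi_{12-k,D_k})(Z)$ converges absolutely, and $$\mathrm{Lift}(\psi_{12-k,D_k})(Z)=\sum_{\substack{n,m\in\mathbb Z_{>0}\\ \ell\in D_k^\vee}}\ \sum_{d\mid(n,\ell,m)}d^{11-k}\,\tau_{24-3k}\!\left(\frac{2nm-\ell^2}{2d^2}\right)\left(\frac{-4}{2\ell/d}\right)e(n\tau+(\ell,\mathfrak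 z)+m\omega),$$ where the sum over $(n,\ell,m)$ converges absolutely. (2) For all integers $N\ge1$ one has $\tau_3(N^2/8)=\left(\frac{-4}{N}\right)N$, and $\tau_3(n/8)=0$ if the positive integer $n$ is not a square. Consequently, for $k=7$, $$\mathrm{Lift}(\psi_{5,D_7})(Z)=\sum_{N\ge1}\ \sum_{\substack{n,m\in\mathbb Z_{>0},\ \ell\in D_7^\vee\\ 2nm-\ell^2=N^2/4}}\ \sum_{d\mid(n,\ell,m)}d^{3}N\left(\frac{-4}{N/d}\right)\left(\frac{-4}{2\ell/d}\right)e(n\tau+(\ell,\mathfrak z)+m\omega),$$ again with absolute convergence of the sum over $(N,n,\ell,m)$; here $N/d$ is always an integer. -/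

import Mathlib

open scoped UpperHalfPlane

namespace DTower

noncomputable section

/-- `e(x) = exp(2πix)`. -/
def e (x : ℂ) : ℂ := Complex.exp (2 * Real.pi * Complex.I * x)

/-- The even lattice `D_k = {x ∈ ℤ^k | x_1 + ⋯ + x_k ∈ 2ℤ}`, inside `ℚ^k`. -/
def latticeD (k : ℕ) : Submodule ℤ (Fin k → ℚ) where
  carrier := {x | ∃ y : Fin k → ℤ, (∀ i, x i = y i) ∧ Even (∑ i, y i)}
  zero_mem' := ⟨0, by simp, by simp⟩
  add_mem' := by
    rintro a b ⟨y, hy, hy'⟩ ⟨w, hw, hw'⟩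
    refine ⟨y + w, fun i => by simp [hy, hw], ?_⟩
    simpa [Finset.sum_add_distrib] using hy'.add hw'
  smul_mem' := by
    rintro c a ⟨y, hy, hy'⟩
    refine ⟨c • y, fun i => by simp [hy], ?_⟩
    simpa [← Finset.mul_sum] using hy'.mul_left c

/-- The dual lattice `D_k^∨ = {ℓ ∈ ℚ^k | (ℓ, x) ∈ ℤ for all x ∈ D_k}` for the Euclidean scalar
product. -/
def dualD (k : ℕ) : Submodule ℤ (Fin k → ℚ) :=
  LinearMap.BilinForm.dualSubmodule (dotProductBilin ℚ ℚ) (latticeD k)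

/-- The square `ℓ² = (ℓ, ℓ)`. -/
def normSq {k : ℕ} (l : Fin k → ℚ) : ℚ := l ⬝ᵥ l

/-- The bilinear pairing `(ℓ, z)` for `ℓ ∈ ℚ^k` and `z ∈ ℂ^k`. -/
def pair {k : ℕ} (l : Fin k → ℚ) (z : Fin k → ℂ) : ℂ := ∑ i, (l i : ℂ) * z i

/-- The product of Kronecker symbols `(-4 / 2ℓ) = ∏ᵢ (-4 / 2ℓᵢ)`. For `ℓ ∈ D_k^∨` (and `k ≥ 2`)
the numbers `2ℓᵢ` are integers, see `two_mul_eq_num`. -/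
def kron {k : ℕ} (l : Fin k → ℚ) : ℤ := ∏ i, ZMod.χ₄ ((2 * l i).num : ZMod 4)

theorem two_mul_eq_num {k : ℕ} {l : Fin k → ℚ} (hl : l ∈ dualD k) (i : Fin k) :
    2 * l i = ((2 * l i).num : ℚ) := by
  have h : (Pi.single i 2 : Fin k → ℚ) ∈ latticeD k := by
    refine ⟨Pi.single i 2, fun j => ?_, by simp⟩
    by_cases hj : j = i
    · subst hj; simp
    · simp [hj]
  obtain ⟨a, ha⟩ := Submodule.mem_one.mp (hl _ h)
  have h2 : 2 * l i = (a : ℚ) := by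
    simpa [dotProductBilin, mul_comm] using ha.symm
  rw [h2, Rat.num_intCast]

/-- The Jacobi theta series `ϑ(τ, z) = ∑_{m ∈ ℤ} (-4 / m) q^{m²/8} ζ^{m/2}`. -/
def theta (τ z : ℂ) : ℂ :=
  ∑' m : ℤ, (ZMod.χ₄ (m : ZMod 4) : ℂ) * e ((m : ℂ) ^ 2 / 8 * τ + (m : ℂ) / 2 * z)

/-- The Jacobi form `ψ_{12-k, D_k}(τ, z) = η(τ)^{24-3k} ϑ(τ, z_1) ⋯ ϑ(τ, z_k)`
(used for `2 ≤ k ≤ 8`). -/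
def psi (k : ℕ) (τ : ℂ) (z : Fin k → ℂ) : ℂ :=
  ModularForm.eta τ ^ (24 - 3 * k) * ∏ i, theta τ (z i)

/-- The coefficient `τ_r(x)` of `q^x` in the expansion of `η(τ)^r` in powers of `q^{1/8}`, with the
value `0` if `x` is not of the form `n/8`, `n ∈ ℕ`. It is used for `r` divisible by `3`, so that
`η(τ)^r` has period `8`. -/
def etaCoeff (r : ℕ) (x : ℚ) : ℂ :=
  if x = (⌊8 * x⌋₊ : ℚ) / 8 then
    (UpperHalfPlane.qExpansion 8 (fun τ : ℍ => ModularForm.eta τ ^ r)).coeff ⌊8 * x⌋₊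
  else 0

/-- The `m`-th term of the Jacobi lifting of a function `φ(τ, z)` taken in weight `w`:
`m⁻¹ ∑_{ad = m, b mod d} a^w φ((aτ + b)/d, az) e(mω)`. -/
def liftTerm {k : ℕ} (w : ℕ) (φ : ℂ → (Fin k → ℂ) → ℂ) (τ : ℂ) (z : Fin k → ℂ) (ω : ℂ)
    (m : ℕ+) : ℂ :=
  (m : ℂ)⁻¹ *
    (∑ p ∈ (m : ℕ).divisorsAntidiagonal, ∑ b ∈ Finset.range p.2,
      (p.1 : ℂ) ^ w * φ (((p.1 : ℂ) * τ + b) / p.2) ((p.1 : ℂ) • z)) * e (m * ω)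

/-- The Jacobi lifting `Lift(φ)(τ, z, ω)` of `φ` in weight `w`. -/
def jacobiLift {k : ℕ} (w : ℕ) (φ : ℂ → (Fin k → ℂ) → ℂ) (τ : ℂ) (z : Fin k → ℂ) (ω : ℂ) : ℂ :=
  ∑' m : ℕ+, liftTerm w φ τ z ω m

/-- The tube domain of points `Z = (ω, z, τ)` with `Im τ > 0`, `Im ω > 0` and
`2 Im τ Im ω - (Im z, Im z) > 0`. -/
def tube (k : ℕ) : Set (ℂ × (Fin k → ℂ) × ℂ) :=
  {Z | 0 < Z.1.im ∧ 0 < Z.2.2.im ∧ 0 < 2 * Z.2.2.im * Z.1.im - ∑ i, (Z.2.1 i).im ^ 2}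

open scoped Classical in
/-- The positive integers `d` dividing the vector `(n, ℓ, m)` in `U ⊕ D_k(-1)^∨`, i.e. `d ∣ n`,
`d ∣ m` and `ℓ/d ∈ D_k^∨`. -/
def commonDivisors {k : ℕ} (n m : ℕ+) (l : Fin k → ℚ) : Finset ℕ :=
  (Nat.gcd n m).divisors.filter fun d => (d : ℚ)⁻¹ • l ∈ dualD k

end

end DTower

namespace DTower

noncomputable section

open Filter Topology

/-! Everything rests on Jacobi's formula for `η ^ 3`. It comes from a finite identity with
`q`-Pochhammer denominators (`hasSum_mul_jacobiTerm`), proved by induction on `n` from the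
recurrence `jacobiTerm_succ`; dominated convergence as `n → ∞` gives `hasSum_jacobi_int`. Taking
powers, the coefficients of `η ^ (3 * r)` become sums over representations by `r` odd squares. Hence
they grow polynomially and are supported on `N ≡ r` mod 8.

Multiplying by `k` theta series expands `ψ` (`hasSum_psi`): the exponents `(N + ∑ mᵢ²) / 8` are
positive integers because `(8 - k) + k = 8`. In the lifting, the sum over `b` mod `d` keeps only the
exponents divisible by `d`. This leaves a series over `((a, d), (n, ℓ))`, which converges absolutely
on the tube domain (`summable_liftFourierTerm`). Grouping it by `a * d` gives the defining series of
the lifting; grouping it by `(a n, a ℓ, a d)` gives the Fourier expansion, where `a` runs over the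
common divisors. For `k = 7` the eta power is `η ^ 3`, so only squares survive. -/

lemma HasSum.of_eq {ι : Type*} {f g : ι → ℂ} {a b : ℂ} (h : HasSum f a) (hf : ∀ i, g i = f i)
    (hab : b = a) : HasSum g b := by
  rw [hab, funext hf]; exact h

/-! ### `q`-Pochhammer products and the finite Jacobi identity. -/

/-- The `q`-Pochhammer symbol `(q; q)_n = ∏_{i=1}^n (1 - q^i)`. -/
def qPoch (q : ℂ) (n : ℕ) : ℂ := ∏ i ∈ Finset.range n, (1 - q ^ (i + 1))

/-- The reciprocal of the `q`-Pochhammer symbol, extended by zero to negative indices. -/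
def qPochInv (q : ℂ) (k : ℤ) : ℂ := if k < 0 then 0 else (qPoch q k.toNat)⁻¹

lemma one_sub_pow_succ_ne_zero {q : ℂ} (hq : ‖q‖ < 1) (n : ℕ) : 1 - q ^ (n + 1) ≠ 0 := by
  intro h
  have h1 : ‖q ^ (n + 1)‖ < 1 := by
    rw [norm_pow]
    exact pow_lt_one₀ (norm_nonneg _) hq (by omega)
  rw [← sub_eq_zero.mp h] at h1
  simp at h1

lemma qPoch_ne_zero {q : ℂ} (hq : ‖q‖ < 1) (n : ℕ) : qPoch q n ≠ 0 :=
  Finset.prod_ne_zero_iff.mpr fun i _ => one_sub_pow_succ_ne_zero hq i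

lemma qPochInv_natCast (q : ℂ) (n : ℕ) : qPochInv q n = (qPoch q n)⁻¹ := by
  simp [qPochInv]

lemma qPochInv_of_neg (q : ℂ) {k : ℤ} (hk : k < 0) : qPochInv q k = 0 := by
  simp [qPochInv, hk]

/-- Extension by zero is compatible with the recursion: at `k = -1` the factor `1 - q ^ 0` vanishes.
Later recurrences therefore hold for every integer `j` without boundary cases. -/
lemma qPochInv_eq {q : ℂ} (hq : ‖q‖ < 1) (k : ℤ) :
    qPochInv q k = (1 - q ^ (k + 1)) * qPochInv q (k + 1) := by
  rcases lt_trichotomy k (-1) with hk | rfl | hk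
  · rw [qPochInv_of_neg q (by omega), qPochInv_of_neg q (by omega), mul_zero]
  · simp [qPochInv]
  · lift k to ℕ using by omega
    have h := one_sub_pow_succ_ne_zero hq k
    have e1 : ((k : ℤ) + 1) = ((k + 1 : ℕ) : ℤ) := by push_cast; rfl
    rw [e1, qPochInv_natCast, qPochInv_natCast, zpow_natCast, qPoch, qPoch, Finset.prod_range_succ,
      mul_inv, mul_comm _ (1 - q ^ (k + 1))⁻¹, ← mul_assoc, mul_inv_cancel₀ h, one_mul]

lemma tendsto_qPoch {q : ℂ} (hq : ‖q‖ < 1) :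
    Tendsto (qPoch q) atTop (𝓝 (∏' n : ℕ, (1 - q ^ (n + 1)))) :=
  (ModularForm.multipliable_one_sub_pow hq).hasProd.tendsto_prod_nat

lemma tprod_one_sub_pow_ne_zero {q : ℂ} (hq : ‖q‖ < 1) :
    ∏' n : ℕ, (1 - q ^ (n + 1)) ≠ 0 := by
  have := tprod_one_add_ne_zero_of_summable (f := fun n : ℕ => -q ^ (n + 1))
    (fun i => by simpa [← sub_eq_add_neg] using one_sub_pow_succ_ne_zero hq i)
    (by simpa using (summable_nat_add_iff 1).mpr (summable_geometric_of_lt_one (norm_nonneg _) hq))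
  simpa [sub_eq_add_neg] using this

lemma tendsto_qPochInv {q : ℂ} (hq : ‖q‖ < 1) :
    Tendsto (qPochInv q) atTop (𝓝 (∏' n : ℕ, (1 - q ^ (n + 1)))⁻¹) := by
  have h := ((tendsto_qPoch hq).inv₀ (tprod_one_sub_pow_ne_zero hq)).comp
    (tendsto_atTop.2 fun n => (eventually_ge_atTop (n : ℤ)).mono fun k hk => by omega :
      Tendsto Int.toNat atTop atTop)
  refine h.congr' ?_
  filter_upwards [eventually_ge_atTop 0] with k hk
  simp [qPochInv, not_lt.mpr hk]

lemma exists_norm_qPochInv_le {q : ℂ} (hq : ‖q‖ < 1) : ∃ C, ∀ k, ‖qPochInv q k‖ ≤ C := by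
  have h := (tendsto_qPoch hq).inv₀ (tprod_one_sub_pow_ne_zero hq)
  obtain ⟨C, hC⟩ := isBounded_iff_forall_norm_le.mp (Metric.isBounded_range_of_tendsto _ h)
  refine ⟨C, fun k => ?_⟩
  have h0 : 0 ≤ C := (norm_nonneg _).trans (hC _ ⟨0, rfl⟩)
  unfold qPochInv
  split_ifs
  · simpa using h0
  · exact hC _ ⟨_, rfl⟩

/-- The terms of the finite form of Jacobi's identity for the cube of the eta function. -/
def jacobiTerm (s : ℂ) (n : ℕ) (j : ℤ) : ℂ :=
  (-1) ^ j * s ^ ((2 * j + 1) ^ 2) * (qPochInv (s ^ 8) (n - j) * qPochInv (s ^ 8) (n + j + 1))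

lemma jacobiTerm_eq_zero (s : ℂ) (n : ℕ) {j : ℤ} (hj : j ∉ Finset.Icc (-(n : ℤ) - 1) n) :
    jacobiTerm s n j = 0 := by
  rw [Finset.mem_Icc, not_and_or, not_le, not_le] at hj
  rcases hj with hj | hj
  · rw [jacobiTerm, qPochInv_of_neg _ (by omega : (n : ℤ) + j + 1 < 0)]; simp
  · rw [jacobiTerm, qPochInv_of_neg _ (by omega : (n : ℤ) - j < 0)]; simp

lemma summable_mul_jacobiTerm (s : ℂ) (n : ℕ) (f : ℤ → ℂ) :
    Summable fun j => f j * jacobiTerm s n j :=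
  summable_of_ne_finset_zero (s := Finset.Icc (-(n : ℤ) - 1) n) fun j hj => by
    rw [jacobiTerm_eq_zero s n hj, mul_zero]

/-- All reciprocal symbols reduce to the two of largest index, at `n - j + 1` and `n + j + 2`; what
remains is a polynomial identity. The symmetry of the right side in `j ± 1` is what makes the weight
`2 * j + 1` tractable in the induction. -/
lemma jacobiTerm_succ {s : ℂ} (hs : s ≠ 0) (hs1 : ‖s‖ < 1) (n : ℕ) (j : ℤ) :
    (1 - (s ^ 8) ^ (2 * n + 2)) * (1 - (s ^ 8) ^ (2 * n + 3)) * jacobiTerm s (n + 1) j =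
      (1 + (s ^ 8) ^ (2 * n + 2)) * jacobiTerm s n j
        - (s ^ 8) ^ (n + 1) * (jacobiTerm s n (j - 1) + jacobiTerm s n (j + 1)) := by
  have hq : ‖s ^ 8‖ < 1 := by
    rw [norm_pow]; exact pow_lt_one₀ (norm_nonneg _) hs1 (by norm_num)
  have hq0 : s ^ 8 ≠ 0 := pow_ne_zero _ hs
  have e1 : ((n + 1 : ℕ) : ℤ) - j = (n - j) + 1 := by push_cast; ring
  have e2 : ((n + 1 : ℕ) : ℤ) + j + 1 = (n + j + 1) + 1 := by push_cast; ring
  have e3 : (n : ℤ) - (j - 1) = (n - j) + 1 := by ring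
  have e4 : (n : ℤ) + (j - 1) + 1 = n + j := by ring
  have e5 : (n : ℤ) - (j + 1) = n - j - 1 := by ring
  have e6 : (n : ℤ) + (j + 1) + 1 = (n + j + 1) + 1 := by ring
  have a1 := qPochInv_eq hq (n - j)
  have a2 := qPochInv_eq hq (n - j - 1)
  have b1 := qPochInv_eq hq (n + j + 1)
  have b2 := qPochInv_eq hq (n + j)
  rw [sub_add_cancel] at a2
  have p1 : s ^ ((2 * (j - 1) + 1) ^ 2) = s ^ ((2 * j + 1) ^ 2) * (s ^ 8) ^ (-j) := by
    rw [← zpow_natCast, ← zpow_mul, ← zpow_add₀ hs]; congr 1; push_cast; ring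
  have p2 : s ^ ((2 * (j + 1) + 1) ^ 2) = s ^ ((2 * j + 1) ^ 2) * (s ^ 8) ^ (j + 1) := by
    rw [← zpow_natCast, ← zpow_mul, ← zpow_add₀ hs]; congr 1; push_cast; ring
  have m1 : (-1 : ℂ) ^ (j - 1) = -(-1) ^ j := by rw [zpow_sub₀ (by norm_num)]; simp [div_neg]
  have m2 : (-1 : ℂ) ^ (j + 1) = -(-1) ^ j := by rw [zpow_add₀ (by norm_num)]; simp
  unfold jacobiTerm
  rw [e1, e2, e3, e4, e5, e6, p1, p2, m1, m2, b2, a2, b1, a1]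
  have x1 : (s ^ 8) ^ ((n : ℤ) - j + 1) = (s ^ 8) ^ (n + 1) * (s ^ 8) ^ (-j) := by
    rw [← zpow_natCast, ← zpow_natCast, ← zpow_mul, ← zpow_mul, ← zpow_mul, ← zpow_add₀ hs]
    congr 1; push_cast; ring
  have x2 : (s ^ 8) ^ ((n : ℤ) + j + 1 + 1) = (s ^ 8) ^ (n + 1) * (s ^ 8) ^ (j + 1) := by
    rw [← zpow_natCast, ← zpow_natCast, ← zpow_mul, ← zpow_mul, ← zpow_mul, ← zpow_add₀ hs]
    congr 1; push_cast; ring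
  have x3 : (s ^ 8) ^ ((n : ℤ) - j) = (s ^ 8) ^ n * (s ^ 8) ^ (-j) := by
    rw [← zpow_natCast, ← zpow_natCast, ← zpow_mul, ← zpow_mul, ← zpow_mul, ← zpow_add₀ hs]
    congr 1; push_cast; ring
  have x4 : (s ^ 8) ^ ((n : ℤ) + j + 1) = (s ^ 8) ^ n * (s ^ 8) ^ (j + 1) := by
    rw [← zpow_natCast, ← zpow_natCast, ← zpow_mul, ← zpow_mul, ← zpow_mul, ← zpow_add₀ hs]
    congr 1; push_cast; ring
  -- The only relation needed between the two `j`-dependent powers, used to eliminate `s ^ 8`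
  -- itself.
  have x5 : (s ^ 8) ^ (j + 1) * (s ^ 8) ^ (-j) = s ^ 8 := by
    rw [← zpow_add₀ hq0]; simp
  rw [x1, x2, x3, x4]
  generalize (s ^ 8) ^ (j + 1) = X at *
  generalize (s ^ 8) ^ (-j) = Y at *
  generalize qPochInv (s ^ 8) ((n : ℤ) - j + 1) = A
  generalize qPochInv (s ^ 8) ((n : ℤ) + j + 1 + 1) = B
  rw [pow_succ (s ^ 8) n, show (s ^ 8) ^ (2 * n + 2) = ((s ^ 8) ^ n) ^ 2 * (s ^ 8) ^ 2 by ring,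
    show (s ^ 8) ^ (2 * n + 3) = ((s ^ 8) ^ n) ^ 2 * (s ^ 8) ^ 3 by ring]
  generalize (s ^ 8) ^ n = T at *
  rw [← x5]
  ring

/-- The finite form of Jacobi's identity for the cube of the eta function. -/
lemma hasSum_mul_jacobiTerm {s : ℂ} (hs : s ≠ 0) (hs1 : ‖s‖ < 1) (n : ℕ) :
    HasSum (fun j : ℤ => (2 * j + 1 : ℂ) * jacobiTerm s n j)
      (2 * s * (qPoch (s ^ 8) n ^ 2 * qPochInv (s ^ 8) (2 * n + 1))) := by
  have hq : ‖s ^ 8‖ < 1 := by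
    rw [norm_pow]; exact pow_lt_one₀ (norm_nonneg _) hs1 (by norm_num)
  induction n with
  | zero =>
    have h : HasSum (fun j : ℤ => (2 * j + 1 : ℂ) * jacobiTerm s 0 j)
        (∑ j ∈ Finset.Icc (-1 : ℤ) 0, (2 * j + 1 : ℂ) * jacobiTerm s 0 j) :=
      hasSum_sum_of_ne_finset_zero fun j hj => by
        rw [jacobiTerm_eq_zero s 0 (by simpa using hj), mul_zero]
    convert! h using 1
    rw [show Finset.Icc (-1 : ℤ) 0 = {-1, 0} by decide, Finset.sum_pair (by norm_num)]
    simp [jacobiTerm, qPoch, qPochInv]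
    ring
  | succ n ih =>
    have h1 := one_sub_pow_succ_ne_zero hq (2 * n + 1)
    have h2 := one_sub_pow_succ_ne_zero hq (2 * n + 2)
    set T := 2 * s * (qPoch (s ^ 8) n ^ 2 * qPochInv (s ^ 8) (2 * n + 1)) with hT
    -- `V` is the unweighted sum. Shifting `j` changes the weight by `±2`, so the shifted sums are
    -- `T ± 2 * V` and `V` cancels. The factor left on `T` is `1 + q ^ (2n+2) - 2 q ^ (n+1) = (1 - q
    -- ^ (n+1)) ^ 2`, with `q = s ^ 8`.
    obtain ⟨V, hV⟩ := summable_mul_jacobiTerm s n 1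
    simp only [Pi.one_apply, one_mul] at hV
    have hl : HasSum (fun j : ℤ => (2 * j + 1 : ℂ) * jacobiTerm s n (j - 1)) (T + 2 * V) := by
      rw [← (Equiv.addRight (1 : ℤ)).hasSum_iff]
      refine HasSum.of_eq (ih.add (hV.mul_left 2)) ?_ rfl
      intro j
      simp only [Function.comp, Equiv.coe_addRight, add_sub_cancel_right]
      push_cast; ring
    have hr : HasSum (fun j : ℤ => (2 * j + 1 : ℂ) * jacobiTerm s n (j + 1)) (T - 2 * V) := by
      rw [← (Equiv.addRight (-1 : ℤ)).hasSum_iff]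
      refine HasSum.of_eq (ih.sub (hV.mul_left 2)) ?_ rfl
      intro j
      simp only [Function.comp, Equiv.coe_addRight, neg_add_cancel_right]
      push_cast; ring
    have h := (((ih.mul_left (1 + (s ^ 8) ^ (2 * n + 2))).sub
      ((hl.add hr).mul_left ((s ^ 8) ^ (n + 1))))).mul_left
        ((1 - (s ^ 8) ^ (2 * n + 1 + 1)) * (1 - (s ^ 8) ^ (2 * n + 2 + 1)))⁻¹
    convert! h using 1
    · funext j
      rw [eq_inv_mul_iff_mul_eq₀ (mul_ne_zero h1 h2)]
      linear_combination (2 * j + 1 : ℂ) * jacobiTerm_succ hs hs1 n j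
    · rw [eq_inv_mul_iff_mul_eq₀ (mul_ne_zero h1 h2), hT]
      have e1 : (2 * ((n + 1 : ℕ) : ℤ) + 1) = ((2 * n + 1 + 1 + 1 : ℕ) : ℤ) := by push_cast; ring
      have e2 : (2 * (n : ℤ) + 1) = ((2 * n + 1 : ℕ) : ℤ) := by push_cast; ring
      rw [e1, e2, qPochInv_natCast, qPochInv_natCast]
      have h0 := qPoch_ne_zero hq (2 * n + 1)
      simp only [qPoch, Finset.prod_range_succ _ n, Finset.prod_range_succ _ (2 * n + 1 + 1),
        Finset.prod_range_succ _ (2 * n + 1)] at h0 ⊢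
      generalize (∏ x ∈ Finset.range (2 * n + 1), (1 - (s ^ 8) ^ (x + 1))) = P at *
      field_simp
      ring

/-! ### Passage to the limit and the cube of the eta function. -/

/-- The indices `n` and `-(n + 1)` give the same odd square, and `(2n+1)² ≥ n` leaves a geometric
majorant. It dominates the finite identities uniformly in `n`. -/
lemma summable_mul_pow_sq {r : ℝ} (h0 : 0 < r) (h1 : r < 1) :
    Summable fun j : ℤ => ‖(2 * j + 1 : ℂ)‖ * r ^ ((2 * j + 1) ^ 2) := by
  have key : Summable fun n : ℕ => (2 * n + 1 : ℝ) * r ^ n := by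
    have a := (summable_pow_mul_geometric_of_norm_lt_one 1 (r := r)
      (by rwa [Real.norm_of_nonneg h0.le])).mul_left 2
    have b := summable_geometric_of_lt_one h0.le h1
    refine (a.add b).congr fun n => by ring
  have bound : ∀ n : ℕ, ∀ j : ℤ, (j = n ∨ j = -(n + 1 : ℕ)) →
      ‖(2 * j + 1 : ℂ)‖ * r ^ ((2 * j + 1) ^ 2) ≤ (2 * n + 1) * r ^ n := by
    intro n j hj
    have e1 : ‖(2 * j + 1 : ℂ)‖ = 2 * n + 1 := by
      rcases hj with rfl | rfl
      · rw [show (2 * ((n : ℤ) : ℂ) + 1) = ((2 * n + 1 : ℕ) : ℂ) by push_cast; ring,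
          Complex.norm_natCast]; push_cast; ring
      · rw [show (2 * ((-(n + 1 : ℕ) : ℤ) : ℂ) + 1) = -((2 * n + 1 : ℕ) : ℂ) by push_cast; ring,
          norm_neg, Complex.norm_natCast]; push_cast; ring
    have e2 : (2 * j + 1) ^ 2 = (((2 * n + 1) ^ 2 : ℕ) : ℤ) := by
      rcases hj with rfl | rfl <;> push_cast <;> ring
    rw [e1, e2, zpow_natCast]
    gcongr ?_ * ?_
    exact pow_le_pow_of_le_one h0.le h1.le (by nlinarith)
  refine Summable.of_nat_of_neg_add_one ?_ ?_
  · exact key.of_nonneg_of_le (fun n => by positivity) fun n => bound n _ (Or.inl rfl)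
  · exact key.of_nonneg_of_le (fun n => by positivity) fun n => bound n _ (Or.inr (by push_cast; rfl))

/-- **Jacobi's identity** for the cube of Euler's product. -/
theorem hasSum_jacobi_int {s : ℂ} (hs : s ≠ 0) (hs1 : ‖s‖ < 1) :
    HasSum (fun j : ℤ => (2 * j + 1 : ℂ) * ((-1) ^ j * s ^ ((2 * j + 1) ^ 2)))
      (2 * s * (∏' n : ℕ, (1 - (s ^ 8) ^ (n + 1))) ^ 3) := by
  have hq : ‖s ^ 8‖ < 1 := by
    rw [norm_pow]; exact pow_lt_one₀ (norm_nonneg _) hs1 (by norm_num)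
  set P := ∏' n : ℕ, (1 - (s ^ 8) ^ (n + 1)) with hP
  have hP0 : P ≠ 0 := tprod_one_sub_pow_ne_zero hq
  obtain ⟨C, hC⟩ := exists_norm_qPochInv_le hq
  have hS := summable_mul_pow_sq (norm_pos_iff.mpr hs) hs1
  have hC0 : 0 ≤ C := (norm_nonneg _).trans (hC 0)
  have lim := tendsto_tsum_of_dominated_convergence (𝓕 := atTop)
    (f := fun n (j : ℤ) => (2 * j + 1 : ℂ) * jacobiTerm s n j)
    (g := fun j : ℤ => (2 * j + 1 : ℂ) * ((-1) ^ j * s ^ ((2 * j + 1) ^ 2) * (P⁻¹ * P⁻¹)))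
    (hS.mul_right (C * C)) (fun j => by
      refine Tendsto.const_mul _ (Tendsto.const_mul _ (Tendsto.mul ?_ ?_))
      · exact (tendsto_qPochInv hq).comp
          (tendsto_atTop_add_const_right _ (-j) tendsto_natCast_atTop_atTop)
      · refine (tendsto_qPochInv hq).comp ?_
        simp_rw [add_assoc]
        exact tendsto_atTop_add_const_right _ (j + 1) tendsto_natCast_atTop_atTop)
    (Eventually.of_forall fun n j => by
      simp only [jacobiTerm, norm_mul, norm_zpow, norm_neg, norm_one, one_zpow, one_mul]
      rw [mul_assoc]
      gcongr <;> exact hC _)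
  simp_rw [fun n => (hasSum_mul_jacobiTerm hs hs1 n).tsum_eq] at lim
  -- The other side of the finite identity tends to `2 * s * P`; comparing limits and clearing `P⁻¹
  -- * P⁻¹` produces the cube.
  have lim2 : Tendsto (fun n : ℕ => 2 * s * (qPoch (s ^ 8) n ^ 2 * qPochInv (s ^ 8) (2 * n + 1)))
      atTop (𝓝 (2 * s * (P ^ 2 * P⁻¹))) := by
    refine Tendsto.const_mul _ (((tendsto_qPoch hq).pow 2).mul ((tendsto_qPochInv hq).comp ?_))
    exact tendsto_atTop_add_const_right _ 1
      (tendsto_natCast_atTop_atTop.const_mul_atTop' (by norm_num))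
  have e := tendsto_nhds_unique lim lim2
  have hsum : Summable fun j : ℤ => (2 * j + 1 : ℂ) * ((-1) ^ j * s ^ ((2 * j + 1) ^ 2)) :=
    .of_norm (hS.congr fun j => by simp [norm_zpow])
  convert! hsum.hasSum using 1
  simp_rw [← mul_assoc, tsum_mul_right] at e
  simp_rw [← mul_assoc]
  field_simp at e
  linear_combination -e

lemma chi_odd (n : ℕ) : (ZMod.χ₄ ((2 * n + 1 : ℕ) : ZMod 4)) = (-1) ^ n := by
  rw [ZMod.χ₄_nat_eq_if_mod_four]
  rcases Nat.even_or_odd' n with ⟨m, rfl | rfl⟩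
  · have : (2 * (2 * m) + 1) % 4 = 1 := by omega
    simp [this, pow_mul]
  · have : (2 * (2 * m + 1) + 1) % 4 = 3 := by omega
    simp [this, pow_succ, pow_mul]

lemma chi_even (n : ℕ) : (ZMod.χ₄ ((2 * n : ℕ) : ZMod 4)) = 0 := by
  rw [ZMod.χ₄_nat_eq_if_mod_four]
  simp

lemma e_add (x y : ℂ) : e (x + y) = e x * e y := by
  simp [e, mul_add, Complex.exp_add]

lemma e_sum {ι : Type*} (s : Finset ι) (f : ι → ℂ) : e (∑ i ∈ s, f i) = ∏ i ∈ s, e (f i) := by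
  simp [e, Finset.mul_sum, Complex.exp_sum]

lemma e_natCast_mul (n : ℕ) (x : ℂ) : e (n * x) = e x ^ n := by
  rw [e, e, ← Complex.exp_nat_mul]; congr 1; ring

lemma e_ne_zero (x : ℂ) : e x ≠ 0 := Complex.exp_ne_zero _

lemma norm_e (x : ℂ) : ‖e x‖ = Real.exp (-(2 * Real.pi * x.im)) := by
  simp [e, Complex.norm_exp]

lemma norm_e_lt_one {x : ℂ} (hx : 0 < x.im) : ‖e x‖ < 1 := by
  rw [norm_e, Real.exp_lt_one_iff]
  have := Real.pi_pos
  have : 0 < 2 * Real.pi * x.im := by positivity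
  linarith

lemma eta_pow_three (τ : ℂ) :
    ModularForm.eta τ ^ 3 = e (τ / 8) * (∏' n : ℕ, (1 - (e (τ / 8) ^ 8) ^ (n + 1))) ^ 3 := by
  have h1 : ∀ n : ℕ, ModularForm.eta_q n τ = (e (τ / 8) ^ 8) ^ (n + 1) := by
    intro n
    rw [ModularForm.eta_q_eq_pow, ← e_natCast_mul, e]
    congr 2; push_cast; ring
  simp_rw [ModularForm.eta, h1, mul_pow]
  congr 1
  rw [Function.Periodic.qParam, ← Complex.exp_nat_mul, e]
  congr 1; push_cast; ring

/-- **Jacobi's formula** for the cube of the Dedekind eta function. -/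
theorem hasSum_eta_cube {τ : ℂ} (hτ : 0 < τ.im) :
    HasSum (fun N : ℕ => (ZMod.χ₄ (N : ZMod 4) : ℂ) * N * e ((N : ℂ) ^ 2 / 8 * τ))
      (ModularForm.eta τ ^ 3) := by
  have hτ8 : 0 < (τ / 8).im := by
    rw [show τ / 8 = τ / (8 : ℝ) by norm_num, Complex.div_ofReal_im]; positivity
  -- The terms at `n` and `-(n + 1)` are equal, since weight and sign both change sign. The factor
  -- `1 / 2` below removes this duplication.
  have h := (hasSum_jacobi_int (e_ne_zero (τ / 8)) (norm_e_lt_one hτ8)).nat_add_neg_add_one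
  have h2 := h.mul_left (1 / 2)
  have hinj : Function.Injective fun n : ℕ => 2 * n + 1 := fun a b hab => by
    simpa using hab
  rw [← hinj.hasSum_iff]
  · rw [eta_pow_three]
    convert! h2 using 1
    · funext n
      have e1 : (2 * -((n : ℤ) + 1) + 1) ^ 2 = (2 * (n : ℤ) + 1) ^ 2 := by ring
      have e2 : (-1 : ℂ) ^ (-((n : ℤ) + 1)) = -(-1) ^ n := by
        rw [zpow_neg, ← inv_zpow, show ((-1 : ℂ))⁻¹ = -1 by norm_num, zpow_add₀ (by norm_num)]
        simp
      have e3 : e (τ / 8) ^ ((2 * (n : ℤ) + 1) ^ 2) = e (((2 * n + 1 : ℕ) : ℂ) ^ 2 / 8 * τ) := by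
        rw [show (2 * (n : ℤ) + 1) ^ 2 = (((2 * n + 1) ^ 2 : ℕ) : ℤ) by push_cast; ring,
          zpow_natCast, ← e_natCast_mul]
        congr 1; push_cast; ring
      simp only [Function.comp, chi_odd]
      rw [e1, e2, e3]
      push_cast
      rw [zpow_natCast]
      ring
    · ring
  · intro N hN
    have : Even N := by
      by_contra hodd
      rw [Nat.not_even_iff_odd] at hodd
      obtain ⟨m, rfl⟩ := hodd
      exact hN ⟨m, rfl⟩
    obtain ⟨m, rfl⟩ := this.two_dvd
    rw [chi_even]; simp

lemma hasSum_mul_prod {α β : Type*} {f : α → ℂ} {g : β → ℂ} {a b : ℂ} (hf : HasSum f a)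
    (hg : HasSum g b) : HasSum (fun p : α × β => f p.1 * g p.2) (a * b) := by
  have h1 := hf.summable.norm
  have h2 := hg.summable.norm
  apply hf.mul hg
  apply summable_mul_of_summable_norm h1 h2

lemma hasSum_prod_pi {ι : Type*} (k : ℕ) (f : Fin k → ι → ℂ) (hf : ∀ i, Summable (f i)) :
    HasSum (fun m : Fin k → ι => ∏ i, f i (m i)) (∏ i, ∑' x, f i x) := by
  induction k with
  | zero => simp
  | succ k ih =>
    have h := ih (fun i => f i.succ) fun i => hf i.succ
    have h0 := (hf 0).hasSum
    rw [Fin.prod_univ_succ, ← (Fin.consEquiv fun _ => ι).hasSum_iff]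
    refine HasSum.of_eq (hasSum_mul_prod h0 h) (fun p => ?_) rfl
    simp [Fin.prod_univ_succ, Fin.consEquiv]

lemma hasSum_fiber {α β : Type*} (g : α → β) (F : α → ℂ) (b : β) (s : Finset α)
    (hs : ∀ x, x ∈ s ↔ g x = b) : HasSum (fun x : {x // g x = b} => F x) (∑ x ∈ s, F x) :=
  (Equiv.subtypeEquivRight hs).hasSum_iff.mp (s.hasSum F)

/-! ### Coefficients of the powers `η ^ (3 * r)`. -/

/-- The finite set of representations of `N` as a sum of `r` squares of natural numbers. -/
def squareReps (r N : ℕ) : Finset (Fin r → ℕ) :=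
  (Fintype.piFinset fun _ => Finset.range (N + 1)).filter fun M => ∑ i, M i ^ 2 = N

lemma mem_squareReps {r N : ℕ} {M : Fin r → ℕ} : M ∈ squareReps r N ↔ ∑ i, M i ^ 2 = N := by
  simp only [squareReps, Finset.mem_filter, Fintype.mem_piFinset, Finset.mem_range,
    and_iff_right_iff_imp]
  rintro rfl i
  have h1 := Finset.single_le_sum (f := fun i => M i ^ 2) (fun _ _ => Nat.zero_le _)
    (Finset.mem_univ i)
  have h2 := Nat.le_self_pow two_ne_zero (M i)
  omega

/-- The coefficient of `q^{N/8}` in `η^{3r}`, as obtained from Jacobi's formula. -/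
def etaCubeCoeff (r N : ℕ) : ℤ := ∑ M ∈ squareReps r N, ∏ i, (ZMod.χ₄ (M i : ZMod 4) * M i)

lemma hasSum_etaCubeCoeff (r : ℕ) {τ : ℂ} (hτ : 0 < τ.im) :
    HasSum (fun N : ℕ => (etaCubeCoeff r N : ℂ) * e ((N : ℂ) / 8 * τ))
      (ModularForm.eta τ ^ (3 * r)) := by
  have h := hasSum_prod_pi r (fun _ (N : ℕ) =>
    (ZMod.χ₄ (N : ZMod 4) : ℂ) * N * e ((N : ℂ) ^ 2 / 8 * τ)) fun _ => (hasSum_eta_cube hτ).summable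
  simp only [(hasSum_eta_cube hτ).tsum_eq, Finset.prod_const, Finset.card_univ, Fintype.card_fin,
    ← pow_mul] at h
  rw [← (Equiv.sigmaFiberEquiv fun M : Fin r → ℕ => ∑ i, M i ^ 2).hasSum_iff] at h
  refine h.sigma fun N => ?_
  refine HasSum.of_eq (hasSum_fiber (fun M : Fin r → ℕ => ∑ i, M i ^ 2)
    (fun M => ∏ i, ((ZMod.χ₄ (M i : ZMod 4) : ℂ) * M i * e ((M i : ℂ) ^ 2 / 8 * τ))) N (squareReps r N)
    fun M => mem_squareReps) (fun M => rfl) ?_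
  simp only [etaCubeCoeff]
  push_cast
  rw [Finset.sum_mul]
  refine Finset.sum_congr rfl fun M hM => ?_
  rw [Finset.prod_mul_distrib (g := fun i => e _), ← e_sum, ← Finset.sum_mul, ← Finset.sum_div]
  rw [← mem_squareReps.mp hM]
  push_cast
  rfl

lemma e_intCast (n : ℤ) : e n = 1 := by
  rw [e, mul_comm]; exact Complex.exp_int_mul_two_pi_mul_I n

lemma eta_pow_add_eight (r : ℕ) {τ : ℂ} (hτ : 0 < τ.im) :
    ModularForm.eta (τ + 8) ^ (3 * r) = ModularForm.eta τ ^ (3 * r) := by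
  refine (hasSum_etaCubeCoeff r (by simpa using hτ)).unique
    (HasSum.of_eq (hasSum_etaCubeCoeff r hτ) (fun N => ?_) rfl)
  rw [mul_add, e_add, show (N : ℂ) / 8 * 8 = ((N : ℤ) : ℂ) by push_cast; ring, e_intCast, mul_one]

/-- The numbers `etaCubeCoeff r N` are the coefficients of the expansion of `η^{3r}`. -/
theorem qExpansion_eta_coeff (r N : ℕ) :
    (UpperHalfPlane.qExpansion 8 (fun τ : ℍ => ModularForm.eta τ ^ (3 * r))).coeff N =
      etaCubeCoeff r N := by
  have hS : ∀ τ : ℍ, HasSum (fun m : ℕ => (etaCubeCoeff r m : ℂ) •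
      Function.Periodic.qParam 8 τ ^ m) (ModularForm.eta τ ^ (3 * r)) := fun τ => by
    refine HasSum.of_eq (hasSum_etaCubeCoeff r τ.2) (fun m => ?_) rfl
    rw [smul_eq_mul, Function.Periodic.qParam, ← Complex.exp_nat_mul, e]
    congr 2; push_cast; ring
  have hA : AnalyticAt ℂ (UpperHalfPlane.cuspFunction 8
      fun τ : ℍ => ModularForm.eta τ ^ (3 * r)) 0 := ?_
  -- The uniqueness theorem is stated for function-like types; plain functions are given the
  -- identity coercion.
  · let _ : FunLike (ℍ → ℂ) ℍ ℂ := ⟨id, fun _ _ h => h⟩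
    exact (UpperHalfPlane.qExpansion_coeff_unique (F := ℍ → ℂ)
      (fun τ : ℍ => ModularForm.eta τ ^ (3 * r)) (by norm_num) hA hS N).symm
  refine UpperHalfPlane.analyticAt_cuspFunction_zero (by norm_num) ?_ ?_
    (UpperHalfPlane.isBoundedAtImInfty_of_hasSum_qExpansion (by norm_num) hS)
  · intro w
    by_cases hw : 0 < w.im
    · have hw8 : 0 < (w + ((8 : ℝ) : ℂ)).im := by simpa using hw
      simp only [Function.comp, UpperHalfPlane.ofComplex_apply_of_im_pos hw,
        UpperHalfPlane.ofComplex_apply_of_im_pos hw8]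
      simpa using eta_pow_add_eight r hw
    -- Off the upper half-plane `UpperHalfPlane.ofComplex` takes a constant default value, so
    -- periodicity is automatic.
    · have hw8 : (w + ((8 : ℝ) : ℂ)).im ≤ 0 := by simpa using hw
      simp only [Function.comp, UpperHalfPlane.ofComplex_apply_of_im_nonpos (not_lt.mp hw),
        UpperHalfPlane.ofComplex_apply_of_im_nonpos hw8]
  · rw [UpperHalfPlane.mdifferentiable_iff]
    intro z hz
    refine DifferentiableWithinAt.congr (f := fun z => ModularForm.eta z ^ (3 * r))
      ((ModularForm.differentiableAt_eta_of_mem_upperHalfPlaneSet hz).pow _).differentiableWithinAt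
      (fun y hy => ?_) ?_
    · simp [UpperHalfPlane.ofComplex_apply_of_im_pos hy]
    · simp [UpperHalfPlane.ofComplex_apply_of_im_pos hz]

lemma etaCoeff_natCast_div (r N : ℕ) : etaCoeff (3 * r) ((N : ℚ) / 8) = etaCubeCoeff r N := by
  have h : ⌊8 * ((N : ℚ) / 8)⌋₊ = N := by
    rw [mul_div_cancel₀ _ (by norm_num), Nat.floor_natCast]
  rw [etaCoeff, h, if_pos rfl, qExpansion_eta_coeff]

lemma exists_eq_of_etaCoeff_ne_zero {r : ℕ} {x : ℚ} (h : etaCoeff r x ≠ 0) :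
    ∃ N : ℕ, x = (N : ℚ) / 8 := by
  refine ⟨⌊8 * x⌋₊, ?_⟩
  by_contra hx
  exact h (if_neg hx)

lemma odd_of_chi_ne_zero {N : ℤ} (h : ZMod.χ₄ (N : ZMod 4) ≠ 0) : Odd N := by
  rw [ZMod.χ₄_int_eq_if_mod_four] at h
  rw [← Int.not_even_iff_odd, Int.even_iff]
  aesop

lemma odd_sq_emod_eight {N : ℤ} (h : Odd N) : N ^ 2 ≡ 1 [ZMOD 8] := by
  obtain ⟨m, rfl⟩ := h
  obtain ⟨c, hc⟩ := Int.even_mul_succ_self m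
  exact (Int.modEq_iff_dvd.mpr ⟨c, by linear_combination 4 * hc⟩).symm

lemma exists_odd_of_etaCubeCoeff_ne_zero {r N : ℕ} (h : etaCubeCoeff r N ≠ 0) :
    ∃ M : Fin r → ℕ, (∀ i, Odd (M i)) ∧ ∑ i, M i ^ 2 = N := by
  obtain ⟨M, hM, hM0⟩ := Finset.exists_ne_zero_of_sum_ne_zero h
  refine ⟨M, fun i => ?_, mem_squareReps.mp hM⟩
  have := Finset.prod_ne_zero_iff.mp hM0 i (Finset.mem_univ i)
  have h2 := odd_of_chi_ne_zero (N := (M i : ℤ)) (by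
    simpa using left_ne_zero_of_mul this)
  exact_mod_cast h2

/-- Odd squares are 1 mod 8. This congruence later makes the exponents of `ψ` integral. -/
lemma modEq_of_etaCubeCoeff_ne_zero {r N : ℕ} (h : etaCubeCoeff r N ≠ 0) :
    (N : ℤ) ≡ r [ZMOD 8] := by
  obtain ⟨M, hM, rfl⟩ := exists_odd_of_etaCubeCoeff_ne_zero h
  have : (∑ i, (M i : ℤ) ^ 2) ≡ ∑ i : Fin r, 1 [ZMOD 8] :=
    Int.ModEq.sum fun i _ => odd_sq_emod_eight (by exact_mod_cast hM i)
  simpa using this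

lemma etaCubeCoeff_zero_right {r : ℕ} (hr : 0 < r) : etaCubeCoeff r 0 = 0 := by
  by_contra h
  obtain ⟨M, hM, h0⟩ := exists_odd_of_etaCubeCoeff_ne_zero h
  have h1 := (hM ⟨0, hr⟩).pos
  have h2 := (Finset.sum_eq_zero_iff.mp h0) ⟨0, hr⟩ (Finset.mem_univ _)
  rw [pow_eq_zero_iff two_ne_zero] at h2
  omega

lemma etaCubeCoeff_zero_left (N : ℕ) : etaCubeCoeff 0 N = if N = 0 then 1 else 0 := by
  unfold etaCubeCoeff squareReps
  by_cases h : N = 0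
  · subst h; simp
  · rw [if_neg h]
    simp [Ne.symm h]

lemma etaCubeCoeff_one_sq (N : ℕ) : etaCubeCoeff 1 (N ^ 2) = ZMod.χ₄ (N : ZMod 4) * N := by
  unfold etaCubeCoeff
  rw [Finset.sum_eq_single (fun _ => N)]
  · simp
  · intro M hM hne
    refine absurd (funext fun i => ?_) hne
    have := mem_squareReps.mp hM
    simp only [Fin.sum_univ_one] at this
    rw [Subsingleton.elim i 0]
    exact Nat.pow_left_injective two_ne_zero this
  · intro h
    exact absurd (mem_squareReps.mpr (by simp)) h

lemma chi_abs_le_one (a : ZMod 4) : |ZMod.χ₄ a| ≤ 1 := by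
  revert a; decide

/-- Crude count: at most `(N+1)^r` tuples, each with product at most `(N+1)^r`. Polynomial growth is
all that convergence needs. -/
lemma abs_etaCubeCoeff_le (r N : ℕ) : |etaCubeCoeff r N| ≤ ((N : ℤ) + 1) ^ (2 * r) := by
  have h1 : ∀ M ∈ squareReps r N, |∏ i, (ZMod.χ₄ (M i : ZMod 4) * M i)| ≤ ((N : ℤ) + 1) ^ r := by
    intro M hM
    rw [Finset.abs_prod]
    refine (Finset.prod_le_prod (g := fun _ => (N : ℤ) + 1) (fun i _ => abs_nonneg _)
      fun i _ => ?_).trans (by simp)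
    have hi : M i < N + 1 := by
      have := (Finset.mem_filter.mp hM).1
      exact Finset.mem_range.mp (Fintype.mem_piFinset.mp this i)
    rw [abs_mul, Nat.abs_cast]
    have := chi_abs_le_one (M i : ZMod 4)
    nlinarith [abs_nonneg (ZMod.χ₄ (M i : ZMod 4))]
  have h2 : (squareReps r N).card ≤ (N + 1) ^ r := by
    refine (Finset.card_filter_le _ _).trans ?_
    simp
  refine (Finset.abs_sum_le_sum_abs _ _).trans ((Finset.sum_le_card_nsmul _ _ _ h1).trans ?_)
  rw [nsmul_eq_mul, two_mul, pow_add]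
  gcongr
  exact_mod_cast h2

lemma norm_etaCubeCoeff_le (r N : ℕ) : ‖(etaCubeCoeff r N : ℂ)‖ ≤ ((N : ℝ) + 1) ^ (2 * r) := by
  rw [Complex.norm_intCast]
  exact_mod_cast abs_etaCubeCoeff_le r N

lemma hasSum_theta {τ : ℂ} (hτ : 0 < τ.im) (z : ℂ) :
    HasSum (fun m : ℤ => (ZMod.χ₄ (m : ZMod 4) : ℂ) * e ((m : ℂ) ^ 2 / 8 * τ + (m : ℂ) / 2 * z))
      (theta τ z) := by
  refine Summable.hasSum ?_
  have hτ4 : 0 < (τ / 4).im := by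
    rw [show τ / 4 = τ / (4 : ℝ) by norm_num, Complex.div_ofReal_im]; positivity
  have h := ((summable_jacobiTheta₂_term_iff (z / 2) (τ / 4)).mpr hτ4).norm
  refine h.of_norm_bounded fun m => ?_
  have e1 : e ((m : ℂ) ^ 2 / 8 * τ + (m : ℂ) / 2 * z) = jacobiTheta₂_term m (z / 2) (τ / 4) := by
    rw [e, jacobiTheta₂_term]; congr 1; ring
  rw [e1, norm_mul]
  refine mul_le_of_le_one_left (norm_nonneg _) ?_
  rw [Complex.norm_intCast]
  exact_mod_cast chi_abs_le_one (m : ZMod 4)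

/-! ### Fourier expansion of `ψ`. -/

/-- The Fourier coefficients of `ψ_{12-k, D_k}`. -/
def psiCoeff (k : ℕ) (n : ℚ) (l : Fin k → ℚ) : ℂ :=
  etaCoeff (24 - 3 * k) (n - normSq l / 2) * (kron l : ℂ)

lemma normSq_eq {k : ℕ} (l : Fin k → ℚ) : normSq l = ∑ i, l i ^ 2 := by
  simp [normSq, dotProduct, sq]

lemma normSq_smul {k : ℕ} (c : ℚ) (l : Fin k → ℚ) : normSq (c • l) = c ^ 2 * normSq l := by
  simp [normSq_eq, Finset.mul_sum, mul_pow]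

lemma pair_smul {k : ℕ} (c : ℚ) (l : Fin k → ℚ) (z : Fin k → ℂ) :
    pair (c • l) z = c * pair l z := by
  simp [pair, Finset.mul_sum, mul_assoc]

lemma pair_smul_right {k : ℕ} (c : ℂ) (l : Fin k → ℚ) (z : Fin k → ℂ) :
    pair l (c • z) = c * pair l z := by
  simp [pair, Finset.mul_sum, mul_left_comm]

/-- The vector `2ℓ` of integers attached to `ℓ ∈ D_k^∨`. -/
def twice {k : ℕ} (l : Fin k → ℚ) (i : Fin k) : ℤ := (2 * l i).num

lemma eq_twice_div {k : ℕ} {l : Fin k → ℚ} (hl : l ∈ dualD k) (i : Fin k) :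
    l i = (twice l i : ℚ) / 2 := by
  rw [twice, ← two_mul_eq_num hl i]; ring

lemma twice_div {k : ℕ} (m : Fin k → ℤ) : twice (fun i => (m i : ℚ) / 2) = m := by
  funext i
  rw [twice, mul_div_cancel₀ _ (by norm_num), Rat.num_intCast]

lemma twice_injOn {k : ℕ} : Set.InjOn (twice (k := k)) (dualD k) := by
  intro l hl l' hl' h
  funext i
  rw [eq_twice_div hl, eq_twice_div hl', h]

lemma normSq_eq_twice {k : ℕ} {l : Fin k → ℚ} (hl : l ∈ dualD k) :
    normSq l = ((∑ i, twice l i ^ 2 : ℤ) : ℚ) / 4 := by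
  rw [normSq_eq]
  push_cast
  rw [Finset.sum_div]
  refine Finset.sum_congr rfl fun i _ => ?_
  rw [eq_twice_div hl i]
  ring

lemma kron_eq {k : ℕ} (l : Fin k → ℚ) : kron l = ∏ i, ZMod.χ₄ (twice l i : ZMod 4) := rfl

/-- For odd `mᵢ`, `∑ mᵢ yᵢ ≡ ∑ yᵢ` mod 2, and the latter is even on `D_k`. -/
lemma div_two_mem_dualD {k : ℕ} {m : Fin k → ℤ} (hm : ∀ i, Odd (m i)) :
    (fun i => (m i : ℚ) / 2) ∈ dualD k := by
  rintro x ⟨y, hy, hy2⟩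
  have h2 : Even (∑ i, m i * y i) := by
    rw [Int.even_iff] at *
    have : ∑ i, m i * y i ≡ ∑ i, y i [ZMOD 2] := by
      refine Int.ModEq.sum fun i _ => ?_
      have h1 : m i ≡ 1 [ZMOD 2] := Int.odd_iff.mp (hm i)
      simpa using h1.mul_right (y i)
    exact Eq.trans this hy2
  obtain ⟨c, hc⟩ := h2
  refine Submodule.mem_one.mpr ⟨c, ?_⟩
  have hc' : ∑ i, (m i : ℚ) * y i = c + c := by exact_mod_cast hc
  have : ∑ i, (m i : ℚ) / 2 * x i = c := by
    simp_rw [hy, div_mul_eq_mul_div, ← Finset.sum_div, hc']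
    ring
  simpa [dotProductBilin, dotProduct] using this.symm

lemma twenty_four_sub (k : ℕ) : 24 - 3 * k = 3 * (8 - k) := by omega

lemma exists_of_psiCoeff_ne_zero {k : ℕ} {n : ℚ} {l : Fin k → ℚ} (h : psiCoeff k n l ≠ 0) :
    ∃ N : ℕ, n - normSq l / 2 = (N : ℚ) / 8 ∧ psiCoeff k n l = etaCubeCoeff (8 - k) N * kron l ∧
      ∀ i, Odd (twice l i) := by
  obtain ⟨N, hN⟩ := exists_eq_of_etaCoeff_ne_zero (left_ne_zero_of_mul h)
  refine ⟨N, hN, ?_, fun i => ?_⟩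
  · rw [psiCoeff, hN, twenty_four_sub, etaCoeff_natCast_div]
  · have h1 : kron l ≠ 0 := by exact_mod_cast right_ne_zero_of_mul h
    exact odd_of_chi_ne_zero (Finset.prod_ne_zero_iff.mp h1 i (Finset.mem_univ i))

lemma psi_exponent {k : ℕ} {n : ℚ} {l : Fin k → ℚ} (hl : l ∈ dualD k) {N : ℕ}
    (hN : n - normSq l / 2 = (N : ℚ) / 8) (τ : ℂ) (z : Fin k → ℂ) :
    e (n * τ + pair l z) = e ((N : ℂ) / 8 * τ) *
      ∏ i, e ((twice l i : ℂ) ^ 2 / 8 * τ + (twice l i : ℂ) / 2 * z i) := by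
  rw [← e_sum, ← e_add, Finset.sum_add_distrib, ← add_assoc, ← Finset.sum_mul, ← add_mul]
  congr 2
  · rw [normSq_eq_twice hl] at hN
    have hn : n = (N : ℚ) / 8 + ∑ i, (twice l i : ℚ) ^ 2 / 8 := by
      rw [← Finset.sum_div]; push_cast at hN; linarith
    rw [hn]; push_cast; rfl
  · unfold pair
    refine Finset.sum_congr rfl fun i _ => ?_
    rw [eq_twice_div hl i]; push_cast; rfl

/-- The Fourier expansion of `ψ_{12-k, D_k}`. -/
theorem hasSum_psi {k : ℕ} (hk : 0 < k) (hk8 : k ≤ 8) {τ : ℂ} (hτ : 0 < τ.im) (z : Fin k → ℂ) :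
    HasSum (fun p : ℕ+ × dualD k => psiCoeff k p.1 p.2 * e (p.1 * τ + pair (p.2 : Fin k → ℚ) z))
      (psi k τ z) := by
  have hθ := hasSum_prod_pi k (fun i (m : ℤ) =>
    (ZMod.χ₄ (m : ZMod 4) : ℂ) * e ((m : ℂ) ^ 2 / 8 * τ + (m : ℂ) / 2 * z i))
    fun i => (hasSum_theta hτ (z i)).summable
  simp only [(hasSum_theta hτ _).tsum_eq] at hθ
  have h := hasSum_mul_prod (hasSum_etaCubeCoeff (8 - k) hτ) hθ
  rw [← twenty_four_sub] at h
  have hN : ∀ x : Function.support (fun p : ℕ+ × dualD k =>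
      psiCoeff k p.1 p.2 * e (p.1 * τ + pair (p.2 : Fin k → ℚ) z)),
      ∃ N : ℕ, (x.1.1 : ℚ) - normSq (x.1.2 : Fin k → ℚ) / 2 = (N : ℚ) / 8 ∧
        psiCoeff k x.1.1 x.1.2 = etaCubeCoeff (8 - k) N * kron (x.1.2 : Fin k → ℚ) ∧
          ∀ i, Odd (twice (x.1.2 : Fin k → ℚ) i) :=
    fun x => exists_of_psiCoeff_ne_zero (left_ne_zero_of_mul x.2)
  choose ν hν1 hν2 hν3 using hN
  -- The supports correspond under `(n, ℓ) ↦ (8n - 4ℓ², 2ℓ)`.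
  refine (hasSum_iff_hasSum_of_ne_zero_bij
    (fun x => (ν x, twice (x.1.2 : Fin k → ℚ))) ?_ ?_ ?_).mp h
  · intro x y hxy
    obtain ⟨h1, h2⟩ := Prod.mk.inj hxy
    have h3 : x.1.2 = y.1.2 := Subtype.ext (twice_injOn x.1.2.2 y.1.2.2 h2)
    have h4 : (x.1.1 : ℚ) = y.1.1 := by
      have := (hν1 x).trans ((congrArg (fun N : ℕ => (N : ℚ) / 8) h1).trans (hν1 y).symm)
      rwa [h3, sub_left_inj] at this
    exact Subtype.ext (Prod.ext (by exact_mod_cast h4) h3)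
  · rintro ⟨N, m⟩ hNm
    have h1 : etaCubeCoeff (8 - k) N ≠ 0 := by
      exact_mod_cast left_ne_zero_of_mul (left_ne_zero_of_mul hNm)
    have h2 : ∀ i, Odd (m i) := fun i => by
      have := Finset.prod_ne_zero_iff.mp (right_ne_zero_of_mul hNm) i (Finset.mem_univ i)
      exact odd_of_chi_ne_zero (by exact_mod_cast left_ne_zero_of_mul this)
    have h3 : (N : ℤ) + ∑ i, m i ^ 2 ≡ 0 [ZMOD 8] := by
      have a := modEq_of_etaCubeCoeff_ne_zero h1
      have b : (∑ i, m i ^ 2) ≡ ∑ i : Fin k, 1 [ZMOD 8] :=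
        Int.ModEq.sum fun i _ => odd_sq_emod_eight (h2 i)
      refine (a.add b).trans ?_
      simp [hk8, Int.ModEq]
    obtain ⟨c, hc⟩ := (Int.modEq_zero_iff_dvd).mp h3
    -- Since `k > 0` there is at least one odd `mᵢ`, so the exponent `n` is positive.
    have h4 : 0 < ∑ i, m i ^ 2 :=
      Finset.sum_pos (fun i _ => by have := h2 i; exact sq_pos_of_ne_zero (by rintro h; simp [h] at this)) ⟨⟨0, hk⟩, Finset.mem_univ _⟩
    have hc0 : 0 < c := by omega
    lift c to ℕ using hc0.le
    obtain ⟨n, rfl⟩ : ∃ n : ℕ+, (n : ℕ) = c := ⟨⟨c, by exact_mod_cast hc0⟩, rfl⟩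
    have hl := div_two_mem_dualD h2
    have hnl : (n : ℚ) - normSq (fun i => (m i : ℚ) / 2) / 2 = (N : ℚ) / 8 := by
      rw [normSq_eq_twice hl, twice_div]
      have : ((N : ℤ) : ℚ) + ((∑ i, m i ^ 2 : ℤ) : ℚ) = 8 * (n : ℚ) := by exact_mod_cast hc
      push_cast at this ⊢
      linarith
    have hS : (n, (⟨_, hl⟩ : dualD k)) ∈ Function.support (fun p : ℕ+ × dualD k =>
        psiCoeff k p.1 p.2 * e (p.1 * τ + pair (p.2 : Fin k → ℚ) z)) := by
      refine mul_ne_zero (mul_ne_zero ?_ ?_) (e_ne_zero _)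
      · change etaCoeff _ ((n : ℚ) - normSq (fun i => (m i : ℚ) / 2) / 2) ≠ 0
        rw [hnl, twenty_four_sub, etaCoeff_natCast_div]; exact_mod_cast h1
      · change ((kron fun i => (m i : ℚ) / 2 : ℤ) : ℂ) ≠ 0
        rw [kron_eq, twice_div]
        have := right_ne_zero_of_mul hNm
        simp only [Finset.prod_mul_distrib] at this
        exact_mod_cast left_ne_zero_of_mul this
    refine ⟨⟨_, hS⟩, Prod.ext ?_ (twice_div m)⟩
    have h8 := (div_left_inj' (by norm_num)).mp ((hν1 ⟨_, hS⟩).symm.trans hnl)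
    exact_mod_cast h8
  · rintro ⟨⟨n, l⟩, hx⟩
    dsimp only
    have := psi_exponent l.2 (hν1 ⟨⟨n, l⟩, hx⟩) τ z
    simp only at this
    push_cast at this
    rw [hν2 ⟨⟨n, l⟩, hx⟩, this, Finset.prod_mul_distrib, kron_eq]
    push_cast
    ring

/-! ### Absolute convergence on the tube domain. -/

/-- The domain is open: `c` is chosen so that `2 (y - c) (v - c) = T + 2c² ≥ T`, keeping `(y - c, t,
v - c)` in the closed cone. Cauchy–Schwarz and then `4AB ≤ (A + B)²` give the bound. -/
lemma exists_tube_bound {k : ℕ} {t : Fin k → ℝ} {y v : ℝ} (hy : 0 < y) (hv : 0 < v)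
    (h : 0 < 2 * y * v - ∑ i, t i ^ 2) :
    ∃ c > 0, ∀ (n d : ℝ) (l : Fin k → ℝ), 0 ≤ n → 0 ≤ d → ∑ i, l i ^ 2 ≤ 2 * (d * n) →
      c * (n + d) ≤ n * y + ∑ i, l i * t i + d * v := by
  set T := ∑ i, t i ^ 2 with hT
  have hT0 : 0 ≤ T := by positivity
  set c := (2 * y * v - T) / (2 * (y + v)) with hc
  have hc1 : c * (2 * (y + v)) = 2 * y * v - T := div_mul_cancel₀ _ (by positivity)
  have hc0 : 0 < c := by positivity
  have hcy : 0 ≤ y - c := by nlinarith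
  have hcv : 0 ≤ v - c := by nlinarith
  refine ⟨c, hc0, fun n d l hn hd hl => ?_⟩
  have h1 : (∑ i, l i * t i) ^ 2 ≤ (n * (y - c) + d * (v - c)) ^ 2 := calc
    (∑ i, l i * t i) ^ 2 ≤ (∑ i, l i ^ 2) * T := Finset.sum_mul_sq_le_sq_mul_sq _ _ _
    _ ≤ (2 * (d * n)) * (2 * (y - c) * (v - c)) := by
      refine mul_le_mul hl ?_ hT0 (by positivity)
      nlinarith
    _ ≤ _ := by nlinarith [sq_nonneg (n * (y - c) - d * (v - c))]
  have h2 := neg_le_of_abs_le (abs_le_of_sq_le_sq h1 (by positivity))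
  linarith

lemma summable_inv_one_add_sq : Summable fun m : ℤ => (1 + (m : ℝ) ^ 2)⁻¹ := by
  have h : Summable fun m : ℤ => 1 / (m : ℝ) ^ 2 :=
    Real.summable_one_div_int_pow.mpr one_lt_two
  refine h.of_norm_bounded_eventually ?_
  refine (Set.finite_singleton (0 : ℤ)).subset fun m hm => ?_
  by_contra hm0
  refine hm ?_
  have : 0 < (m : ℝ) ^ 2 := by have : m ≠ 0 := hm0; positivity
  change ‖(1 + (m : ℝ) ^ 2)⁻¹‖ ≤ _
  rw [Real.norm_of_nonneg (by positivity), one_div]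
  exact inv_anti₀ this (by linarith)

lemma summable_prod_inv_one_add_sq (k : ℕ) :
    Summable fun l : dualD k => ∏ i, (1 + (twice (l : Fin k → ℚ) i : ℝ) ^ 2)⁻¹ := by
  have h := (hasSum_prod_pi k (fun _ (m : ℤ) => (((1 + (m : ℝ) ^ 2)⁻¹ : ℝ) : ℂ))
    fun _ => Complex.summable_ofReal.mpr summable_inv_one_add_sq).summable
  simp_rw [← Complex.ofReal_prod] at h
  have hinj : Function.Injective fun l : dualD k => twice (l : Fin k → ℚ) :=
    fun l l' hll => Subtype.ext (twice_injOn l.2 l'.2 hll)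
  exact (Complex.summable_ofReal.mp h).comp_injective hinj

/-- A nonzero coefficient forces `N + ∑ (2ℓᵢ)² = 8n`, hence `1 + (2ℓᵢ)² ≤ 8n + 1` for each `i`.
Paying `(8n + 1)^k` thus buys summability over `ℓ`. -/
lemma norm_psiCoeff_le {k n : ℕ} {l : Fin k → ℚ} (hl : l ∈ dualD k) :
    ‖psiCoeff k n l‖ ≤
      (8 * n + 1 : ℝ) ^ (2 * (8 - k) + k) * ∏ i, (1 + (twice l i : ℝ) ^ 2)⁻¹ := by
  by_cases h0 : psiCoeff k n l = 0
  · rw [h0, norm_zero]; positivity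
  obtain ⟨N, hN, hψ, -⟩ := exists_of_psiCoeff_ne_zero h0
  have hsum : (N : ℝ) + ∑ i, (twice l i : ℝ) ^ 2 = 8 * n := by
    rw [normSq_eq_twice hl] at hN
    have : (N : ℚ) + ∑ i, (twice l i : ℚ) ^ 2 = 8 * n := by push_cast at hN; linarith
    exact_mod_cast this
  have hS : 0 ≤ ∑ i, (twice l i : ℝ) ^ 2 := by positivity
  have hkron : ‖(kron l : ℂ)‖ ≤ 1 := by
    rw [Complex.norm_intCast]
    have : |kron l| ≤ 1 := by
      rw [kron_eq, Finset.abs_prod]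
      exact Finset.prod_le_one (fun _ _ => abs_nonneg _) fun _ _ => chi_abs_le_one _
    exact_mod_cast this
  have hprod : 1 ≤ ∏ i, ((8 * n + 1 : ℝ) * (1 + (twice l i : ℝ) ^ 2)⁻¹) := by
    have : ∏ i : Fin k, (1 : ℝ) ≤ ∏ i, ((8 * n + 1 : ℝ) * (1 + (twice l i : ℝ) ^ 2)⁻¹) := by
      refine Finset.prod_le_prod (fun _ _ => zero_le_one) fun i _ => ?_
      rw [← div_eq_mul_inv, one_le_div (by positivity)]
      have := Finset.single_le_sum (f := fun i => (twice l i : ℝ) ^ 2) (fun _ _ => by positivity)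
        (Finset.mem_univ i)
      have hN0 : (0 : ℝ) ≤ N := by positivity
      linarith
    simpa using this
  rw [Finset.prod_mul_distrib, Finset.prod_const, Finset.card_univ, Fintype.card_fin] at hprod
  rw [hψ, norm_mul, pow_add, mul_assoc]
  calc _ ≤ ((N : ℝ) + 1) ^ (2 * (8 - k)) * 1 :=
        mul_le_mul (norm_etaCubeCoeff_le _ _) hkron (norm_nonneg _) (by positivity)
    _ ≤ _ := by
      gcongr
      linarith

/-- The terms of the Jacobi lifting of `ψ_{12-k, D_k}`, indexed by `((a, d), (n, ℓ))`. -/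
def liftFourierTerm (k : ℕ) (τ : ℂ) (z : Fin k → ℂ) (ω : ℂ) (p : (ℕ+ × ℕ+) × (ℕ+ × dualD k)) :
    ℂ :=
  (p.1.1 : ℂ) ^ (11 - k) * psiCoeff k ((p.1.2 * p.2.1 : ℕ) : ℚ) p.2.2 *
    e (p.1.1 * (p.2.1 * τ + pair (p.2.2 : Fin k → ℚ) z + p.1.2 * ω))

lemma pair_im {k : ℕ} (l : Fin k → ℚ) (z : Fin k → ℂ) :
    (pair l z).im = ∑ i, (l i : ℝ) * (z i).im := by
  simp [pair, Complex.im_sum]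

lemma summable_mul_prod {α β : Type*} {f : α → ℝ} {g : β → ℝ} (hf : Summable f) (hg : Summable g)
    (hf0 : ∀ x, 0 ≤ f x) (hg0 : ∀ x, 0 ≤ g x) : Summable fun p : α × β => f p.1 * g p.2 :=
  hf.mul_of_nonneg hg hf0 hg0

lemma summable_pnat_pow_mul_exp (A : ℕ) {c : ℝ} (hc : 0 < c) :
    Summable fun n : ℕ+ => (n : ℝ) ^ A * Real.exp (-c * n) :=
  (Real.summable_pow_mul_exp_neg_nat_mul A hc).comp_injective PNat.coe_injective

/-- The majorant of the Fourier expansion of the lifting. -/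
def liftMajorant (k A B : ℕ) (c : ℝ) (p : (ℕ+ × ℕ+) × (ℕ+ × dualD k)) : ℝ :=
  (((p.1.1 : ℝ) ^ A * Real.exp (-c * p.1.1)) * ((p.1.2 : ℝ) ^ B * Real.exp (-c * p.1.2))) *
    (((p.2.1 : ℝ) ^ B * Real.exp (-c * p.2.1)) *
      ∏ i, (1 + (twice (p.2.2 : Fin k → ℚ) i : ℝ) ^ 2)⁻¹)

lemma liftMajorant_nonneg (k A B : ℕ) (c : ℝ) (p : (ℕ+ × ℕ+) × (ℕ+ × dualD k)) :
    0 ≤ liftMajorant k A B c p := by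
  unfold liftMajorant; positivity

lemma summable_liftMajorant (k A B : ℕ) {c : ℝ} (hc : 0 < c) : Summable (liftMajorant k A B c) := by
  have h0 : ∀ (D : ℕ) (n : ℕ+), 0 ≤ (n : ℝ) ^ D * Real.exp (-c * n) := fun D n => by positivity
  have hP : ∀ l : dualD k, 0 ≤ ∏ i, (1 + (twice (l : Fin k → ℚ) i : ℝ) ^ 2)⁻¹ :=
    fun l => by positivity
  have hB := summable_pnat_pow_mul_exp B hc
  have h1 := summable_mul_prod (summable_pnat_pow_mul_exp A hc) hB (h0 A) (h0 B)
  have h2 := summable_mul_prod hB (summable_prod_inv_one_add_sq k) (h0 B) hP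
  have h3 := summable_mul_prod h1 h2 (fun p => mul_nonneg (h0 A p.1) (h0 B p.2))
    fun p => mul_nonneg (h0 B p.1) (hP p.2)
  exact h3.congr fun p => rfl

/-- As `a, d, n ≥ 1`, one has `a + n + d ≤ 2a(n + d)`. Passing from product to sum lets the
exponential bound factor over the three variables. -/
lemma exponent_im_ge {k : ℕ} {τ : ℂ} {z : Fin k → ℂ} {ω : ℂ} {c : ℝ} (hc0 : 0 < c)
    (hc : ∀ (n d : ℝ) (l : Fin k → ℝ), 0 ≤ n → 0 ≤ d → ∑ i, l i ^ 2 ≤ 2 * (d * n) →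
      c * (n + d) ≤ n * τ.im + ∑ i, l i * (z i).im + d * ω.im)
    (a d n : ℕ+) (l : Fin k → ℚ) (hψ : psiCoeff k ((d * n : ℕ) : ℚ) l ≠ 0) :
    Real.pi * c * (a + n + d) ≤ 2 * Real.pi * (a * (n * τ + pair l z + d * ω) : ℂ).im := by
  have hπ := Real.pi_pos
  have ha : (1 : ℝ) ≤ a := by exact_mod_cast one_le (a := a)
  have hd : (1 : ℝ) ≤ d := by exact_mod_cast one_le (a := d)
  have hn : (1 : ℝ) ≤ n := by exact_mod_cast one_le (a := n)
  obtain ⟨N, hN, -⟩ := exists_of_psiCoeff_ne_zero hψ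
  have hl : normSq l ≤ 2 * ((d : ℚ) * n) := by
    have : (0 : ℚ) ≤ (N : ℚ) / 8 := by positivity
    push_cast at hN
    linarith
  rw [normSq_eq] at hl
  have hl' : ∑ i, ((l i : ℚ) : ℝ) ^ 2 ≤ 2 * ((d : ℝ) * n) := by exact_mod_cast hl
  have key := hc n d _ (by positivity) (by positivity) hl'
  have him : (a * (n * τ + pair l z + d * ω) : ℂ).im =
      a * (n * τ.im + ∑ i, (l i : ℝ) * (z i).im + d * ω.im) := by
    simp [pair_im]
  rw [him]
  have h5 : (a + n + d : ℝ) ≤ 2 * (a * (n + d)) := by nlinarith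
  calc Real.pi * c * (a + n + d) ≤ Real.pi * c * (2 * (a * (n + d))) := by gcongr
    _ = 2 * Real.pi * (a * (c * (n + d))) := by ring
    _ ≤ _ := by gcongr

lemma norm_liftFourierTerm_le {k : ℕ} {τ : ℂ} {z : Fin k → ℂ} {ω : ℂ} {c : ℝ} (hc0 : 0 < c)
    (hc : ∀ (n d : ℝ) (l : Fin k → ℝ), 0 ≤ n → 0 ≤ d → ∑ i, l i ^ 2 ≤ 2 * (d * n) →
      c * (n + d) ≤ n * τ.im + ∑ i, l i * (z i).im + d * ω.im)
    (p : (ℕ+ × ℕ+) × (ℕ+ × dualD k)) :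
    ‖liftFourierTerm k τ z ω p‖ ≤ 9 ^ (2 * (8 - k) + k) *
      liftMajorant k (11 - k) (2 * (8 - k) + k) (Real.pi * c) p := by
  obtain ⟨⟨a, d⟩, n, l⟩ := p
  by_cases hψ : psiCoeff k ((d * n : ℕ) : ℚ) l = 0
  · have : liftFourierTerm k τ z ω ((a, d), n, l) = 0 := by
      simp only [liftFourierTerm, hψ, mul_zero, zero_mul]
    rw [this, norm_zero]
    exact mul_nonneg (by positivity) (liftMajorant_nonneg _ _ _ _ _)
  have hexpo := exponent_im_ge hc0 hc a d n l hψ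
  have hd : (1 : ℝ) ≤ d := by exact_mod_cast one_le (a := d)
  have hn : (1 : ℝ) ≤ n := by exact_mod_cast one_le (a := n)
  have hcoef := norm_psiCoeff_le (n := (d * n : ℕ)) l.2
  have h9 : (8 * ((d * n : ℕ) : ℝ) + 1) ≤ 9 * (d * n) := by push_cast; nlinarith
  have hP : 0 ≤ ∏ i, (1 + (twice (l : Fin k → ℚ) i : ℝ) ^ 2)⁻¹ := by positivity
  simp only [liftFourierTerm, liftMajorant]
  generalize ∏ i, (1 + (twice (l : Fin k → ℚ) i : ℝ) ^ 2)⁻¹ = P at *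
  generalize 2 * (8 - k) + k = B at *
  rw [norm_mul, norm_mul, norm_e, norm_pow, Complex.norm_natCast]
  have hcoef' : ‖psiCoeff k ((d * n : ℕ) : ℚ) l‖ ≤ (9 * (d * n) : ℝ) ^ B * P :=
    hcoef.trans (mul_le_mul_of_nonneg_right (pow_le_pow_left₀ (by positivity) h9 _) hP)
  refine (mul_le_mul (mul_le_mul_of_nonneg_left hcoef' (by positivity))
    (Real.exp_le_exp.mpr (neg_le_neg hexpo)) (by positivity) (by positivity)).trans_eq ?_
  rw [show -(Real.pi * c * (a + n + d)) = -(Real.pi * c) * a + -(Real.pi * c) * n +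
    -(Real.pi * c) * d by ring, Real.exp_add, Real.exp_add]
  ring

theorem summable_liftFourierTerm {k : ℕ} {τ : ℂ} {z : Fin k → ℂ} {ω : ℂ}
    (hZ : (ω, z, τ) ∈ tube k) : Summable (liftFourierTerm k τ z ω) := by
  obtain ⟨hω, hτ, ht⟩ := hZ
  obtain ⟨c, hc0, hc⟩ := exists_tube_bound (t := fun i => (z i).im) hτ hω ht
  exact ((summable_liftMajorant k _ _ (mul_pos Real.pi_pos hc0)).mul_left _).of_norm_bounded
    fun p => norm_liftFourierTerm_le hc0 hc p

/-! ### The lifting as a Fourier series. -/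

/-- Orthogonality of characters mod `d`: otherwise the sum is geometric with a nontrivial `d`-th
root of unity as ratio. -/
lemma sum_e_mul_div (n d : ℕ) (hd : 0 < d) :
    ∑ b ∈ Finset.range d, e ((n : ℂ) * b / d) = if d ∣ n then (d : ℂ) else 0 := by
  have hd0 : (d : ℂ) ≠ 0 := by exact_mod_cast hd.ne'
  have h1 : ∀ b : ℕ, e ((n : ℂ) * b / d) = e ((n : ℂ) / d) ^ b := fun b => by
    rw [← e_natCast_mul]; congr 1; ring
  simp_rw [h1]
  split_ifs with h
  · obtain ⟨c, rfl⟩ := h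
    have : ((d * c : ℕ) : ℂ) / d = ((c : ℤ) : ℂ) := by push_cast; field_simp
    rw [this, e_intCast]
    simp
  · have hne : e ((n : ℂ) / d) ≠ 1 := by
      intro h1
      obtain ⟨c, hc⟩ := Complex.exp_eq_one_iff.mp h1
      have h2 : (2 * Real.pi * Complex.I : ℂ) ≠ 0 := Complex.two_pi_I_ne_zero
      rw [mul_comm (c : ℂ)] at hc
      have h3 := mul_left_cancel₀ h2 hc
      rw [div_eq_iff hd0] at h3
      refine h (Int.natCast_dvd_natCast.mp ⟨c, ?_⟩)
      rw [mul_comm]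
      exact_mod_cast h3
    rw [geom_sum_eq hne, ← e_natCast_mul, mul_div_cancel₀ _ hd0]
    have : e (n : ℂ) = 1 := e_intCast n
    simp [this]

/-- The contribution of a factorisation `m = ad` to the Jacobi lifting. -/
lemma hasSum_liftFourierTerm_fiber {k : ℕ} (hk : 0 < k) (hk8 : k ≤ 8) {τ : ℂ} (hτ : 0 < τ.im)
    (z : Fin k → ℂ) (ω : ℂ) (a d : ℕ+) :
    HasSum (fun q : ℕ+ × dualD k => liftFourierTerm k τ z ω ((a, d), q))
      ((a * d : ℂ)⁻¹ * (∑ b ∈ Finset.range d,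
        (a : ℂ) ^ (12 - k) * psi k (((a : ℂ) * τ + b) / d) ((a : ℂ) • z)) * e (a * d * ω)) := by
  have ha0 : (a : ℂ) ≠ 0 := by exact_mod_cast a.ne_zero
  have hd0 : (d : ℂ) ≠ 0 := by exact_mod_cast d.ne_zero
  have him : ∀ b : ℕ, 0 < (((a : ℂ) * τ + b) / d).im := fun b => by
    rw [show ((d : ℕ) : ℂ) = ((d : ℝ) : ℂ) by push_cast; rfl, Complex.div_ofReal_im]
    have h1 : (0 : ℝ) < a := by exact_mod_cast a.pos
    have h2 : (0 : ℝ) < d := by exact_mod_cast d.pos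
    simp
    positivity
  have h := ((hasSum_sum fun b (_ : b ∈ Finset.range (d : ℕ)) =>
    (hasSum_psi hk hk8 (him b) ((a : ℂ) • z)).mul_left ((a : ℂ) ^ (12 - k))).mul_left
      (a * d : ℂ)⁻¹).mul_right (e (a * d * ω))
  have hterm : ∀ (n : ℕ+) (l : dualD k), ∑ b ∈ Finset.range (d : ℕ), (a : ℂ) ^ (12 - k) *
      (psiCoeff k n l * e (n * (((a : ℂ) * τ + b) / d) + pair (l : Fin k → ℚ) ((a : ℂ) • z))) =
      (a : ℂ) ^ (12 - k) * psiCoeff k n l * e (n * a / d * τ + a * pair (l : Fin k → ℚ) z) *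
        if (d : ℕ) ∣ n then (d : ℂ) else 0 := by
    intro n l
    rw [← sum_e_mul_div n d d.pos, Finset.mul_sum]
    refine Finset.sum_congr rfl fun b _ => ?_
    rw [pair_smul_right, mul_assoc ((a : ℂ) ^ (12 - k) * _), ← e_add, mul_assoc]
    congr 3
    ring
  simp only [hterm] at h
  -- Only exponents `d * n` survive. The resulting factor `d` cancels against `(a * d)⁻¹`, and the
  -- remaining `a⁻¹` lowers the power `12 - k` to `11 - k`.
  have hinj : Function.Injective fun q : ℕ+ × dualD k => (d * q.1, q.2) := by
    rintro ⟨n, l⟩ ⟨n', l'⟩ h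
    obtain ⟨h1, h2⟩ := Prod.mk.inj h
    exact Prod.ext (mul_left_cancel h1) h2
  rw [← hinj.hasSum_iff] at h
  · refine HasSum.of_eq h ?_ rfl
    rintro ⟨n, l⟩
    simp only [liftFourierTerm, Function.comp, PNat.mul_coe, dvd_mul_right, if_true]
    have e1 : (a : ℂ) * (n * τ + pair (l : Fin k → ℚ) z + d * ω) =
        (((d * n : ℕ) : ℂ) * a / d * τ + a * pair (l : Fin k → ℚ) z) + a * d * ω := by
      push_cast; field_simp
    have e2 : (a : ℂ) ^ (12 - k) = (a : ℂ) ^ (11 - k) * a := by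
      rw [← pow_succ]; congr 1; omega
    rw [e1, e_add, e2]
    field_simp
  · rintro ⟨n, l⟩ hnl
    rw [if_neg, mul_zero, mul_zero, zero_mul]
    intro hdn
    obtain ⟨c, hc⟩ := PNat.dvd_iff.mpr hdn
    exact hnl ⟨(c, l), Prod.ext hc.symm rfl⟩

theorem hasSum_liftTerm {k : ℕ} (hk : 0 < k) (hk8 : k ≤ 8) {τ : ℂ} {z : Fin k → ℂ} {ω : ℂ}
    (hZ : (ω, z, τ) ∈ tube k) :
    HasSum (liftTerm (12 - k) (psi k) τ z ω) (∑' p, liftFourierTerm k τ z ω p) := by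
  have h := (summable_liftFourierTerm hZ).hasSum.prod_fiberwise fun p =>
    hasSum_liftFourierTerm_fiber hk hk8 hZ.2.1 z ω p.1 p.2
  rw [← sigmaAntidiagonalEquivProd.hasSum_iff] at h
  refine h.sigma fun m => ?_
  have hm := ((m : ℕ).divisorsAntidiagonal).hasSum fun p : ℕ × ℕ =>
    ((p.1 : ℂ) * p.2)⁻¹ * (∑ b ∈ Finset.range p.2, (p.1 : ℂ) ^ (12 - k) *
      psi k (((p.1 : ℂ) * τ + b) / p.2) ((p.1 : ℂ) • z)) * e (p.1 * p.2 * ω)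
  refine HasSum.of_eq hm (fun p => rfl) ?_
  rw [liftTerm, Finset.mul_sum, Finset.sum_mul]
  refine Finset.sum_congr rfl fun p hp => ?_
  have : (m : ℂ) = p.1 * p.2 := by exact_mod_cast (Nat.mem_divisorsAntidiagonal.mp hp).1.symm
  rw [this]

lemma jacobiLift_eq_tsum {k : ℕ} (hk : 0 < k) (hk8 : k ≤ 8) {τ : ℂ} {z : Fin k → ℂ} {ω : ℂ}
    (hZ : (ω, z, τ) ∈ tube k) :
    jacobiLift (12 - k) (psi k) τ z ω = ∑' p, liftFourierTerm k τ z ω p :=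
  (hasSum_liftTerm hk hk8 hZ).tsum_eq

lemma mem_commonDivisors {k : ℕ} {n m : ℕ+} {l : Fin k → ℚ} {d : ℕ} :
    d ∈ commonDivisors n m l ↔ d ∣ n ∧ d ∣ m ∧ (d : ℚ)⁻¹ • l ∈ dualD k := by
  have : Nat.gcd n m ≠ 0 := Nat.gcd_ne_zero_left n.ne_zero
  simp [commonDivisors, Nat.dvd_gcd_iff, and_assoc]

/-- The index `(n, ℓ, m) = (a n', a ℓ', a d)` of the Fourier coefficient to which the term with
index `((a, d), (n', ℓ'))` of the lifting contributes. -/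
def fourierIndex {k : ℕ} (p : (ℕ+ × ℕ+) × (ℕ+ × dualD k)) : ℕ+ × dualD k × ℕ+ :=
  (p.1.1 * p.2.1, ((p.1.1 : ℕ) : ℤ) • p.2.2, p.1.1 * p.1.2)

lemma coe_smul_dualD {k : ℕ} (a : ℕ) (l : dualD k) :
    (((a : ℤ) • l : dualD k) : Fin k → ℚ) = (a : ℚ) • (l : Fin k → ℚ) := by
  ext i; simp

/-- The Fourier terms of the lifting, before summation over the common divisors. -/
def divisorTerm (k : ℕ) (τ : ℂ) (z : Fin k → ℂ) (ω : ℂ) (p : ℕ+ × dualD k × ℕ+) (d : ℕ) : ℂ :=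
  (d : ℂ) ^ (11 - k)
    * etaCoeff (24 - 3 * k)
        ((2 * (p.1 : ℚ) * (p.2.2 : ℚ) - normSq (p.2.1 : Fin k → ℚ)) / (2 * (d : ℚ) ^ 2))
    * (kron ((d : ℚ)⁻¹ • (p.2.1 : Fin k → ℚ)) : ℂ)
    * e (p.1 * τ + pair (p.2.1 : Fin k → ℚ) z + p.2.2 * ω)

/-- Homogeneity: `(2(an)(ad) - (aℓ)²) / (2a²) = dn - ℓ²/2`. -/
lemma liftFourierTerm_eq {k : ℕ} (τ : ℂ) (z : Fin k → ℂ) (ω : ℂ)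
    (p : (ℕ+ × ℕ+) × (ℕ+ × dualD k)) :
    liftFourierTerm k τ z ω p = divisorTerm k τ z ω (fourierIndex p) p.1.1 := by
  obtain ⟨⟨a, d⟩, n, l⟩ := p
  have ha : (a : ℚ) ≠ 0 := by exact_mod_cast a.ne_zero
  simp only [liftFourierTerm, divisorTerm, fourierIndex, coe_smul_dualD, normSq_smul, pair_smul,
    smul_smul, inv_mul_cancel₀ ha, one_smul, psiCoeff, PNat.mul_coe]
  rw [← mul_assoc ((a : ℂ) ^ (11 - k))]
  congr 2
  · congr 3
    push_cast
    field_simp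
  · push_cast
    ring_nf

lemma mem_commonDivisors_of_fourierIndex {k : ℕ} (p : (ℕ+ × ℕ+) × (ℕ+ × dualD k)) :
    (p.1.1 : ℕ) ∈ commonDivisors (fourierIndex p).1 (fourierIndex p).2.2
      ((fourierIndex p).2.1 : Fin k → ℚ) := by
  have ha : (p.1.1 : ℚ) ≠ 0 := by exact_mod_cast p.1.1.ne_zero
  refine mem_commonDivisors.mpr ⟨⟨p.2.1, rfl⟩, ⟨p.1.2, rfl⟩, ?_⟩
  simp only [fourierIndex, coe_smul_dualD, smul_smul, inv_mul_cancel₀ ha, one_smul]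
  exact p.2.2.2

/-- The terms of the lifting contributing to a given Fourier coefficient correspond to the common
divisors of its index. -/
def fourierIndexFiberEquiv {k : ℕ} (q : ℕ+ × dualD k × ℕ+) :
    {p : (ℕ+ × ℕ+) × (ℕ+ × dualD k) // fourierIndex p = q} ≃
      commonDivisors q.1 q.2.2 (q.2.1 : Fin k → ℚ) :=
  Equiv.ofBijective (fun p => ⟨p.1.1.1, by
    have := mem_commonDivisors_of_fourierIndex p.1
    rwa [p.2] at this⟩) <| by
  constructor
  · rintro ⟨⟨⟨a, d⟩, n, l⟩, rfl⟩ ⟨⟨⟨a', d'⟩, n', l'⟩, h⟩ haa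
    have ha : a = a' := PNat.coe_injective (Subtype.mk.inj haa)
    subst ha
    simp only [fourierIndex, Prod.mk.injEq, mul_right_inj] at h
    obtain ⟨rfl, h2, rfl⟩ := h
    have : l' = l := by
      apply Subtype.ext
      have h3 := congrArg (Subtype.val) h2
      rw [coe_smul_dualD, coe_smul_dualD] at h3
      exact smul_right_injective _ (by exact_mod_cast a.ne_zero : (a : ℚ) ≠ 0) h3
    subst this
    rfl
  · rintro ⟨a, ha⟩
    obtain ⟨n, l, m⟩ := q
    obtain ⟨h1, h2, h3⟩ := mem_commonDivisors.mp ha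
    have ha0 : 0 < a := Nat.pos_of_dvd_of_pos h1 n.pos
    obtain ⟨a, rfl⟩ : ∃ b : ℕ+, (b : ℕ) = a := ⟨⟨a, ha0⟩, rfl⟩
    obtain ⟨n, rfl⟩ := PNat.dvd_iff.mpr h1
    obtain ⟨d, rfl⟩ := PNat.dvd_iff.mpr h2
    refine ⟨⟨((a, d), (n, ⟨_, h3⟩)), ?_⟩, rfl⟩
    refine Prod.ext rfl (Prod.ext (Subtype.ext ?_) rfl)
    simp only [fourierIndex, coe_smul_dualD, smul_smul]
    rw [mul_inv_cancel₀ (by exact_mod_cast a.ne_zero : (a : ℚ) ≠ 0), one_smul]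

/-- The Fourier expansion of the lifting of `ψ_{12-k, D_k}`. -/
theorem hasSum_jacobiLift {k : ℕ} (hk : 0 < k) (hk8 : k ≤ 8) {τ : ℂ} {z : Fin k → ℂ} {ω : ℂ}
    (hZ : (ω, z, τ) ∈ tube k) :
    HasSum (fun p : ℕ+ × dualD k × ℕ+ =>
        (∑ d ∈ commonDivisors p.1 p.2.2 (p.2.1 : Fin k → ℚ),
          (d : ℂ) ^ (11 - k)
            * etaCoeff (24 - 3 * k)
                ((2 * (p.1 : ℚ) * (p.2.2 : ℚ) - normSq (p.2.1 : Fin k → ℚ))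
                  / (2 * (d : ℚ) ^ 2))
            * (kron ((d : ℚ)⁻¹ • (p.2.1 : Fin k → ℚ)) : ℂ))
          * e (p.1 * τ + pair (p.2.1 : Fin k → ℚ) z + p.2.2 * ω))
      (jacobiLift (12 - k) (psi k) τ z ω) := by
  rw [jacobiLift_eq_tsum hk hk8 hZ]
  have h := (summable_liftFourierTerm hZ).hasSum
  rw [← (Equiv.sigmaFiberEquiv (fourierIndex (k := k))).hasSum_iff] at h
  refine h.sigma fun q => ?_
  rw [Finset.sum_mul]
  refine HasSum.of_eq ((fourierIndexFiberEquiv q).hasSum_iff.mpr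
    ((commonDivisors q.1 q.2.2 (q.2.1 : Fin k → ℚ)).hasSum (divisorTerm k τ z ω q)))
    (fun p => ?_) rfl
  obtain ⟨p, rfl⟩ := p
  exact liftFourierTerm_eq τ z ω p

/-! ### The case `k = 7`. -/

lemma etaCoeff_three_sq (N : ℕ) :
    etaCoeff 3 ((N : ℚ) ^ 2 / 8) = (ZMod.χ₄ (N : ZMod 4) : ℂ) * N := by
  have := etaCoeff_natCast_div 1 (N ^ 2)
  rw [etaCubeCoeff_one_sq, mul_one] at this
  push_cast at this
  exact this

lemma exists_of_etaCoeff_three_ne_zero {x : ℚ} (h : etaCoeff 3 x ≠ 0) :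
    ∃ N : ℕ+, x = (N : ℚ) ^ 2 / 8 := by
  obtain ⟨N, rfl⟩ := exists_eq_of_etaCoeff_ne_zero h
  have h1 := etaCoeff_natCast_div 1 N
  rw [mul_one] at h1
  rw [h1] at h
  obtain ⟨M, hM, rfl⟩ := exists_odd_of_etaCubeCoeff_ne_zero (by exact_mod_cast h)
  refine ⟨⟨M 0, (hM 0).pos⟩, ?_⟩
  simp

lemma etaCoeff_zero_left (x : ℚ) : etaCoeff 0 x = if x = 0 then 1 else 0 := by
  by_cases hx : ∃ N : ℕ, x = (N : ℚ) / 8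
  · obtain ⟨N, rfl⟩ := hx
    have := etaCoeff_natCast_div 0 N
    rw [mul_zero] at this
    rw [this, etaCubeCoeff_zero_left]
    simp
  · rw [if_neg fun h => hx ⟨0, by simp [h]⟩]
    by_contra h
    exact hx (exists_eq_of_etaCoeff_ne_zero h)

/-- A common divisor of `(n, ℓ, m)` divides `N` if `2nm - ℓ² = N²/4`. -/
lemma dvd_of_mem_commonDivisors {k : ℕ} {N n m : ℕ+} {l : Fin k → ℚ} {d : ℕ}
    (hd : d ∈ commonDivisors n m l)
    (h : 2 * (n : ℚ) * (m : ℚ) - normSq l = (N : ℚ) ^ 2 / 4) : d ∣ N := by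
  obtain ⟨⟨n', hn⟩, ⟨m', hm⟩, hl⟩ := mem_commonDivisors.mp hd
  have hd0 : (d : ℚ) ≠ 0 := by
    rintro h0
    have : d = 0 := by exact_mod_cast h0
    exact n.ne_zero (by rw [hn, this, zero_mul])
  -- Because `ℓ/d` is again in the dual lattice, `4(ℓ/d)²` is an integer; thus `d² ∣ N²`.
  have h1 := normSq_eq_twice hl
  rw [normSq_smul] at h1
  set s := ∑ i, twice ((d : ℚ)⁻¹ • l) i ^ 2
  have h2 : normSq l = (d : ℚ) ^ 2 * (s / 4) := by rw [← h1]; field_simp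
  have h3 : (N : ℚ) ^ 2 = (d : ℚ) ^ 2 * (8 * n' * m' - s) := by
    rw [hn, hm, h2] at h
    push_cast at h
    linarith
  have h4 : ((N : ℕ) : ℤ) ^ 2 = (d : ℤ) ^ 2 * (8 * n' * m' - s) := by exact_mod_cast h3
  exact Int.natCast_dvd_natCast.mp ((Int.pow_dvd_pow_iff two_ne_zero).mp ⟨_, h4⟩)

theorem hasSum_jacobiLift_seven {τ : ℂ} {z : Fin 7 → ℂ} {ω : ℂ} (hZ : (ω, z, τ) ∈ tube 7) :
    HasSum
      (fun p : {p : ℕ+ × ℕ+ × dualD 7 × ℕ+ //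
          2 * (p.2.1 : ℚ) * (p.2.2.2 : ℚ) - normSq (p.2.2.1 : Fin 7 → ℚ)
            = (p.1 : ℚ) ^ 2 / 4} =>
        (∑ d ∈ commonDivisors p.1.2.1 p.1.2.2.2 (p.1.2.2.1 : Fin 7 → ℚ),
          (d : ℂ) ^ 3 * (p.1.1 : ℂ)
            * (ZMod.χ₄ (((p.1.1 : ℕ) / d : ℕ) : ZMod 4) : ℂ)
            * (kron ((d : ℚ)⁻¹ • (p.1.2.2.1 : Fin 7 → ℚ)) : ℂ))
          * e (p.1.2.1 * τ + pair (p.1.2.2.1 : Fin 7 → ℚ) z + p.1.2.2.2 * ω))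
      (jacobiLift 5 (psi 7) τ z ω) := by
  have h := hasSum_jacobiLift (k := 7) (by norm_num) (by norm_num) hZ
  simp only [Nat.reduceSub, Nat.reduceMul] at h
  -- The positive integer `N` is determined by `(n, ℓ, m)`, so adding it to the index creates no
  -- repetition.
  have hinj : Function.Injective fun p : {p : ℕ+ × ℕ+ × dualD 7 × ℕ+ //
      2 * (p.2.1 : ℚ) * (p.2.2.2 : ℚ) - normSq (p.2.2.1 : Fin 7 → ℚ) = (p.1 : ℚ) ^ 2 / 4} =>
      p.1.2 := by
    rintro ⟨⟨N, q⟩, hN⟩ ⟨⟨N', q'⟩, hN'⟩ (rfl : q = q')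
    have h1 : (N : ℚ) ^ 2 / 4 = (N' : ℚ) ^ 2 / 4 := hN.symm.trans hN'
    have h2 : (N : ℚ) ^ 2 = (N' : ℚ) ^ 2 := by linarith
    have h3 := (sq_eq_sq₀ (by positivity) (by positivity)).mp h2
    have h4 : N = N' := by exact_mod_cast h3
    subst h4
    rfl
  rw [← hinj.hasSum_iff] at h
  · refine HasSum.of_eq h ?_ rfl
    rintro ⟨⟨N, n, l, m⟩, hN⟩
    simp only [Function.comp] at hN ⊢
    congr 1
    refine Finset.sum_congr rfl fun d hd => ?_
    obtain ⟨c, hc⟩ := dvd_of_mem_commonDivisors hd hN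
    have hd0 : d ≠ 0 := by
      rintro rfl
      exact N.ne_zero (by rw [hc, zero_mul])
    -- With `N = d * c` the coefficient is `χ₄(c) * c`; one of the four factors `d` is absorbed into
    -- `N`, leaving `d ^ 3`.
    have hx : (N : ℚ) ^ 2 / 4 / (2 * (d : ℚ) ^ 2) = (c : ℚ) ^ 2 / 8 := by
      have : (d : ℚ) ≠ 0 := by exact_mod_cast hd0
      rw [hc]; push_cast; field_simp; ring
    rw [hN, hx, etaCoeff_three_sq, hc, Nat.mul_div_cancel_left _ (Nat.pos_of_ne_zero hd0)]
    push_cast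
    ring
  · rintro ⟨n, l, m⟩ hq
    rw [Finset.sum_eq_zero, zero_mul]
    intro d hd
    have hd0 : d ≠ 0 := by
      rintro rfl
      exact n.ne_zero (zero_dvd_iff.mp (mem_commonDivisors.mp hd).1)
    obtain ⟨d, rfl⟩ : ∃ b : ℕ+, (b : ℕ) = d := ⟨⟨d, Nat.pos_of_ne_zero hd0⟩, rfl⟩
    by_cases h0 : etaCoeff 3 ((2 * (n : ℚ) * (m : ℚ) - normSq (l : Fin 7 → ℚ)) /
        (2 * (d : ℚ) ^ 2)) = 0
    · simp only [h0, mul_zero, zero_mul]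
    -- A nonvanishing term at `d` would put the triple in the range, with `N = d * M`.
    · obtain ⟨M, hM⟩ := exists_of_etaCoeff_three_ne_zero h0
      refine absurd ⟨⟨(d * M, n, l, m), ?_⟩, rfl⟩ hq
      rw [div_eq_iff (by positivity)] at hM
      simp only [PNat.mul_coe]
      rw [hM]
      push_cast
      ring

end

end DTower

open DTower in
theorem corollary3p5 :
    -- the numbers `τ_{3m}(n/8)` are the Fourier coefficients of `η^{3m}`, and `τ_0 = δ_0`
    (∀ (m : ℕ) (τ : ℍ), 0 < m →
      HasSum (fun n : ℕ+ => etaCoeff (3 * m) ((n : ℚ) / 8) * e ((n : ℂ) / 8 * τ))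
        (ModularForm.eta τ ^ (3 * m))) ∧
    (∀ x : ℚ, etaCoeff 0 x = if x = 0 then 1 else 0) ∧
    -- the Fourier expansion of the lifting
    (∀ k : ℕ, 2 ≤ k → k ≤ 8 → ∀ (ω : ℂ) (z : Fin k → ℂ) (τ : ℂ), (ω, z, τ) ∈ tube k →
      Summable (liftTerm (12 - k) (psi k) τ z ω) ∧
      HasSum
        (fun p : ℕ+ × dualD k × ℕ+ =>
          (∑ d ∈ commonDivisors p.1 p.2.2 (p.2.1 : Fin k → ℚ),
            (d : ℂ) ^ (11 - k)
              * etaCoeff (24 - 3 * k)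
                  ((2 * (p.1 : ℚ) * (p.2.2 : ℚ) - normSq (p.2.1 : Fin k → ℚ))
                    / (2 * (d : ℚ) ^ 2))
              * (kron ((d : ℚ)⁻¹ • (p.2.1 : Fin k → ℚ)) : ℂ))
            * e (p.1 * τ + pair (p.2.1 : Fin k → ℚ) z + p.2.2 * ω))
        (jacobiLift (12 - k) (psi k) τ z ω)) ∧
    -- Jacobi's formula for the coefficients of `η ^ 3`
    (∀ N : ℕ+, etaCoeff 3 ((N : ℚ) ^ 2 / 8) = (ZMod.χ₄ (N : ZMod 4) : ℂ) * N) ∧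
    (∀ n : ℕ+, (¬ ∃ N : ℕ+, n = N ^ 2) → etaCoeff 3 ((n : ℚ) / 8) = 0) ∧
    -- the expansion for `D_7`, where `p = (N, n, ℓ, m)`
    (∀ (ω : ℂ) (z : Fin 7 → ℂ) (τ : ℂ), (ω, z, τ) ∈ tube 7 →
      HasSum
        (fun p : {p : ℕ+ × ℕ+ × dualD 7 × ℕ+ //
            2 * (p.2.1 : ℚ) * (p.2.2.2 : ℚ) - normSq (p.2.2.1 : Fin 7 → ℚ)
              = (p.1 : ℚ) ^ 2 / 4} =>
          (∑ d ∈ commonDivisors p.1.2.1 p.1.2.2.2 (p.1.2.2.1 : Fin 7 → ℚ),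
            (d : ℂ) ^ 3 * (p.1.1 : ℂ)
              * (ZMod.χ₄ (((p.1.1 : ℕ) / d : ℕ) : ZMod 4) : ℂ)
              * (kron ((d : ℚ)⁻¹ • (p.1.2.2.1 : Fin 7 → ℚ)) : ℂ))
            * e (p.1.2.1 * τ + pair (p.1.2.2.1 : Fin 7 → ℚ) z + p.1.2.2.2 * ω))
        (jacobiLift 5 (psi 7) τ z ω)) := by
  refine ⟨fun m τ hm => ?_, etaCoeff_zero_left, fun k hk hk8 ω z τ hZ =>
    ⟨(hasSum_liftTerm (by omega) hk8 hZ).summable, hasSum_jacobiLift (by omega) hk8 hZ⟩,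
    fun N => etaCoeff_three_sq N, fun n hn => ?_, fun ω z τ hZ => hasSum_jacobiLift_seven hZ⟩
  · have h := hasSum_etaCubeCoeff m τ.2
    rw [← PNat.coe_injective.hasSum_iff] at h
    · exact HasSum.of_eq h (fun n => by rw [etaCoeff_natCast_div]; rfl) rfl
    · intro N hN
      have : N = 0 := by
        by_contra h0
        exact hN ⟨⟨N, Nat.pos_of_ne_zero h0⟩, rfl⟩
      rw [this, etaCubeCoeff_zero_right hm]
      simp
  · by_contra h
    obtain ⟨N, hN⟩ := exists_of_etaCoeff_three_ne_zero h
    have h8 := (div_left_inj' (by norm_num)).mp hN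
    exact hn ⟨N, by exact_mod_cast h8⟩
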